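/- Fix real numbers $m,\varepsilon>0$. For $0<\delta<1$, consider pairs of functions $A_k(x,t)=A_k(x,t,m,\varepsilon,\delta)\in\mathbb{C}$, $k\in\{1,2\}$, on the set $\{(x,t)\in\mathbb{R}^2: 2x/\varepsilon,\,2t/\varepsilon,\,(x+t)/\varepsilon\in\mathbb{Z}\}$ such that: 1. for each $(x,t)$ with $2x/\varepsilon$ and $2t/\varepsilon$ even, $$A_1(x,t)=\tfrac{1}{\sqrt{1+m^2\varepsilon^2}}\left(A_1(x+\tfrac\varepsilon2,t-\tfrac\varepsilon2)+m\varepsilon A_2(x+\tfrac\varepsilon2,t-\tfrac\varepsilon2)\right),$$ $$A_2(x,t)=\tfrac{1}{\sqrt{1+m^2\varepsilon^2}}\left(A_2(x-\tfrac\varepsilon2,t-\tfrac\varepsilon2)-m\varepsilon A_1(x-\tfrac\varepsilon2,t-\tfrac\varepsilon2)\right)+2\delta_{x0}\delta_{t0},$$ where $\delta_{xy}$ is the Kronecker delta; 2. for each $(x,t)$ with $2x/\varepsilon$ and $2t/\varepsilon$ odd, $$A_1(x,t)=\tfrac{1}{\sqrt{1-\delta^2}}\left(A_1(x+\tfrac\varepsilon2,t-\tfrac\varepsilon2)-i\delta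 A_2(x+\tfrac\varepsilon2,t-\tfrac\varepsilon2)\right),$$ $$A_2(x,t)=\tfrac{1}{\sqrt{1-\delta^2}}\left(A_2(x-\tfrac\varepsilon2,t-\tfrac\varepsilon2)+i\delta A_1(x-\tfrac\varepsilon2,t-\tfrac\varepsilon2)\right);$$ 3. $\sum_{(x,t)\in\varepsilon\mathbb{Z}^2}\left(|A_1(x,t)|^2+|A_2(x,t)|^2\right)<\infty$. Then for each $0<\delta<1$ there is exactly one such pair, for each $k\in\{1,2\}$ and $(x,t)\in\varepsilon\mathbb{Z}^2$ the limit $$\widetilde A_k(x,t,m,\varepsilon):=\lim_{\delta\searrow0}A_k(x,t,m,\varepsilon,\delta)$$ (the lattice propagator) exists, and for each $(x,t)\in\varepsilon\mathbb{Z}^2$ we have $$\widetilde A_1(x,t,m,\varepsilon)=\pm i\,\frac{(-im\varepsilon)^{\frac{t-|x|}{\varepsilon}}}{(1+m^2\varepsilon^2)^{\frac{t}{2\varepsilon}}}\binom{\frac{t+|x|}{2\varepsilon}-\frac12}{|x|/\varepsilon}\,{}_2F_1\left(\frac12+\frac{|x|-t}{2\varepsilon},\frac12+\frac{|x|-t}{2\varepsilon};1+\frac{|x|}{\varepsilon};-\frac1{m^2\varepsilon^2}\right),$$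 $$\widetilde A_2(x,t,m,\varepsilon)=\pm\frac{(-im\varepsilon)^{\frac{t-|x|}{\varepsilon}}}{(1+m^2\varepsilon^2)^{\frac{t}{2\varepsilon}}}\binom{\frac{t+|x|}{2\varepsilon}-1+\theta(x)}{|x|/\varepsilon}\,{}_2F_1\left(\frac{|x|-t}{2\varepsilon},1+\frac{|x|-t}{2\varepsilon};1+\frac{|x|}{\varepsilon};-\frac1{m^2\varepsilon^2}\right),$$ where the minus sign in the expression for $\widetilde A_k$ is taken exactly when $t<0$ and $(x+t)/\varepsilon+k$ is even; $\theta(x):=1$ for $x\ge0$ and $\theta(x):=0$ for $x<0$; $\binom zn:=\frac1{n!}\prod_{j=1}^n(z-j+1)$; and ${}_2F_1(p,q;r;z)$ denotes the (well-defined) value at $z$ of the principal branch of the Gauss hypergeometric function, that is, of the analytic continuation of the Gauss series from a neighbourhood of $0$ to the plane cut along $[1,\infty)$. -/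

import Mathlib

open Filter Topology

noncomputable section

/-! ### The Gauss hypergeometric function -/

/-- `w` is the value at `z` of the holomorphic continuation of the Gauss hypergeometric series
`₂F₁ a b c` (Mathlib's `₂F₁` is the sum of the series) to a neighbourhood of `z` that is star-shaped
about `0`. The largest such domain is the plane cut along `[1, ∞)`; so, for `z` in the cut plane,
this says that `w` is the value at `z` of the principal branch. -/
def IsGaussValue (a b c z w : ℂ) : Prop :=
  ∃ (U : Set ℂ) (F : ℂ → ℂ), IsOpen U ∧ StarConvex ℝ 0 U ∧ z ∈ U ∧
    DifferentiableOn ℂ F U ∧ F =ᶠ[𝓝 0] ₂F₁ a b c ∧ F z = w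

open scoped Classical in
/-- The principal branch of the Gauss hypergeometric function (with value `0` at those `z`
to which the series has no continuation in the above sense). -/
def gauss2F1 (a b c z : ℂ) : ℂ :=
  if h : ∃ w, IsGaussValue a b c z w then h.choose else 0

theorem IsGaussValue.unique {a b c z w w' : ℂ} (h : IsGaussValue a b c z w)
    (h' : IsGaussValue a b c z w') : w = w' := by
  obtain ⟨U, F, hU, hsU, hzU, hF, hF0, rfl⟩ := h
  obtain ⟨V, G, hV, hsV, hzV, hG, hG0, rfl⟩ := h'
  have hs : StarConvex ℝ 0 (U ∩ V) := hsU.inter hsV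
  have h0 : (0 : ℂ) ∈ U ∩ V := hs.mem ⟨z, hzU, hzV⟩
  have hp : IsPreconnected (U ∩ V) := (hs.isPathConnected h0).isConnected.isPreconnected
  have hFa : AnalyticOnNhd ℂ F (U ∩ V) :=
    (hF.mono Set.inter_subset_left).analyticOnNhd (hU.inter hV)
  have hGa : AnalyticOnNhd ℂ G (U ∩ V) :=
    (hG.mono Set.inter_subset_right).analyticOnNhd (hU.inter hV)
  exact hFa.eqOn_of_preconnected_of_eventuallyEq hGa hp h0 (hF0.trans hG0.symm) ⟨hzU, hzV⟩

theorem IsGaussValue.gauss2F1_eq {a b c z w : ℂ} (h : IsGaussValue a b c z w) :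
    gauss2F1 a b c z = w := by
  have hex : ∃ w, IsGaussValue a b c z w := ⟨w, h⟩
  rw [gauss2F1, dif_pos hex]
  exact hex.choose_spec.unique h

/-- Any function holomorphic on the plane cut along `[1, ∞)` that continues the Gauss series
coincides with `gauss2F1` there. -/
theorem gauss2F1_eq_of_differentiableOn {a b c : ℂ} {F : ℂ → ℂ}
    (hF : DifferentiableOn ℂ F {z | 1 - z ∈ Complex.slitPlane}) (hF0 : F =ᶠ[𝓝 0] ₂F₁ a b c)
    {z : ℂ} (hz : 1 - z ∈ Complex.slitPlane) : gauss2F1 a b c z = F z := by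
  refine IsGaussValue.gauss2F1_eq ⟨{z | 1 - z ∈ Complex.slitPlane}, F, ?_, ?_, hz, hF, hF0, rfl⟩
  · exact Complex.isOpen_slitPlane.preimage (continuous_const.sub continuous_id)
  · intro y hy s u hs hu hsu
    have h := Complex.starConvex_one_slitPlane hy hs hu hsu
    have e : (1 : ℂ) - (s • (0 : ℂ) + u • y) = s • (1 : ℂ) + u • (1 - y) := by
      have : (s : ℂ) + u = 1 := by exact_mod_cast hsu
      simp only [Complex.real_smul]
      linear_combination -this
    change (1 : ℂ) - (s • (0 : ℂ) + u • y) ∈ Complex.slitPlane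
    rw [e]
    exact h

/-- The generalized binomial coefficient `(1 / n!) ∏_{j = 1}^{n} (z - j + 1)`. -/
def genBinom (z : ℝ) (n : ℕ) : ℝ :=
  1 / (n.factorial : ℝ) * ∏ j ∈ Finset.Icc 1 n, (z - (j : ℝ) + 1)

/-- `1` for `x ≥ 0` and `0` for `x < 0`. -/
def heavisideStep (x : ℝ) : ℝ := if 0 ≤ x then 1 else 0

/-! ### The lattice propagator -/

/-- Points with `2x/ε` and `2t/ε` even integers, that is, the points of `εℤ²`. -/
def IsEvenPoint (ε x t : ℝ) : Prop :=
  ∃ a b : ℤ, Even a ∧ Even b ∧ 2 * x / ε = a ∧ 2 * t / ε = b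

/-- Points with `2x/ε` and `2t/ε` odd integers, that is, the points of the dual lattice. -/
def IsOddPoint (ε x t : ℝ) : Prop :=
  ∃ a b : ℤ, Odd a ∧ Odd b ∧ 2 * x / ε = a ∧ 2 * t / ε = b

/-- Points with `2x/ε`, `2t/ε`, `(x+t)/ε` integers: the union of the lattice and its dual. -/
def IsLatticePoint (ε x t : ℝ) : Prop :=
  ∃ a b c : ℤ, 2 * x / ε = a ∧ 2 * t / ε = b ∧ (x + t) / ε = c

/-- The pair of functions `A = (A₁, A₂)` on the set of lattice points satisfies the axioms of the
model with lattice step `ε`, mass `m` and small imaginary mass `δ`. Functions on the set of lattice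
points are represented by functions on the plane that vanish at all other points. -/
structure IsAnticheckersField (m ε δ : ℝ) (A : (ℝ → ℝ → ℂ) × (ℝ → ℝ → ℂ)) : Prop where
  support : ∀ x t : ℝ, ¬ IsLatticePoint ε x t → A.1 x t = 0 ∧ A.2 x t = 0
  axiom_one : ∀ x t : ℝ, IsEvenPoint ε x t →
    A.1 x t = 1 / (√(1 + m ^ 2 * ε ^ 2) : ℂ) *
      (A.1 (x + ε / 2) (t - ε / 2) + m * ε * A.2 (x + ε / 2) (t - ε / 2)) ∧
    A.2 x t = 1 / (√(1 + m ^ 2 * ε ^ 2) : ℂ) *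
      (A.2 (x - ε / 2) (t - ε / 2) - m * ε * A.1 (x - ε / 2) (t - ε / 2)) +
      2 * (if x = 0 then 1 else 0) * (if t = 0 then 1 else 0)
  axiom_two : ∀ x t : ℝ, IsOddPoint ε x t →
    A.1 x t = 1 / (√(1 - δ ^ 2) : ℂ) *
      (A.1 (x + ε / 2) (t - ε / 2) - Complex.I * δ * A.2 (x + ε / 2) (t - ε / 2)) ∧
    A.2 x t = 1 / (√(1 - δ ^ 2) : ℂ) *
      (A.2 (x - ε / 2) (t - ε / 2) + Complex.I * δ * A.1 (x - ε / 2) (t - ε / 2))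
  axiom_three : Summable fun p : ℤ × ℤ =>
    ‖A.1 (ε * p.1) (ε * p.2)‖ ^ 2 + ‖A.2 (ε * p.1) (ε * p.2)‖ ^ 2

/-- The pair `(A₁, A₂)` of functions satisfying the axioms. -/
def anticheckersField (m ε δ : ℝ) : (ℝ → ℝ → ℂ) × (ℝ → ℝ → ℂ) :=
  Classical.epsilon (IsAnticheckersField m ε δ)

/-- The first component of the lattice propagator, the limit of `A₁` as `δ ↘ 0`. -/
def latticePropagator₁ (x t m ε : ℝ) : ℂ :=
  limUnder (𝓝[>] (0 : ℝ)) fun δ => (anticheckersField m ε δ).1 x t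

/-- The second component of the lattice propagator, the limit of `A₂` as `δ ↘ 0`. -/
def latticePropagator₂ (x t m ε : ℝ) : ℂ :=
  limUnder (𝓝[>] (0 : ℝ)) fun δ => (anticheckersField m ε δ).2 x t

end

/-! Put μ = mε and κ = 1/√((1+μ²)(1-δ²)). Axiom 2 expresses the values on the dual lattice through
those on εℤ², so a field amounts to a square summable solution on ℤ² of a first-order two-component
system with a point source (`IsLatticeField`). After a Fourier transform in space, one time step is
a 2×2 matrix of determinant 1 and trace 2T, where T = κ cos + iκμδ. By Cayley–Hamilton each
component of a sourceless solution satisfies a scalar wave equation, which says that it is an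
eigenfunction of a self-adjoint operator with the nonreal eigenvalue 2iκμδ; a square summable one
vanishes (`SqSummable.eq_zero_of_wave`), and this gives uniqueness.

For existence, the Green function of the wave operator has the Fourier transform λ^|n| /
(-2i√(1-T²)), where λ is the root of λ² - 2Tλ + 1 in the unit disc. It decays geometrically in |n|,
and the adjugate of the system turns it into a solution (`greenField`). As δ ↘ 0, κ tends to
1/√(1+μ²) < 1, so 1 - T² stays away from 0; dominated convergence gives the limit, which solves the
system with δ = 0 (`isLatticeField_greenField_zero`).

At δ = 0 the evolution is reversible, so a solution is determined by its row n = 0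
(`IsLatticeField.eq_of_time_zero`). It remains to see that the closed form solves the system and has
the right row. Its recurrences, apart from sign and source, are contiguous relations for ₂F₁ at
-1/μ². This point may lie outside the disc of convergence, but it lies in Re z < 1/2, where Pfaff's
transformation gives the continuation by a convergent series. The change of sign at n = 0 produces
exactly the source (`isLatticeField_closedField`). The row n = 0 comes from expanding (1 -
κ²cos²)^(-1/2) and integrating term by term (`closedFst_even_zero`, `closedSnd_succ_zero`). -/

/-! ### Pochhammer symbols and contiguous relations of the Gauss series -/

theorem HasSum.of_eq {ι : Type*} {f g : ι → ℂ} {s : ℂ} (h : HasSum g s) (e : ∀ i, f i = g i) :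
    HasSum f s := by
  rwa [funext e]

theorem ascPochhammer_eval_add_one_mul {R : Type*} [CommSemiring R] (a : R) (n : ℕ) :
    a * (ascPochhammer R n).eval (a + 1) = (ascPochhammer R n).eval a * (a + n) := by
  rw [← ascPochhammer_succ_eval, ascPochhammer_succ_left]
  simp

theorem ascPochhammer_eval_mul_eval_add {R : Type*} [CommSemiring R] (a : R) (n m : ℕ) :
    (ascPochhammer R n).eval a * (ascPochhammer R m).eval (a + n) =
      (ascPochhammer R (n + m)).eval a := by
  rw [← ascPochhammer_mul]
  simp

theorem ascPochhammer_eval_ne_zero {c : ℂ} (hc : ∀ k : ℕ, c + k ≠ 0) (n : ℕ) :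
    (ascPochhammer ℂ n).eval c ≠ 0 := by
  rw [Ne, ascPochhammer_eval_eq_zero_iff]
  rintro ⟨k, -, hk⟩
  exact hc k (by rw [hk]; ring)

theorem ordinaryHypergeometricCoefficient_succ (a b c : ℂ) (n : ℕ) :
    ordinaryHypergeometricCoefficient a b c (n + 1) =
      ordinaryHypergeometricCoefficient a b c n *
        ((a + n) * (b + n) / ((c + n) * (n + 1))) := by
  simp only [ordinaryHypergeometricCoefficient, ascPochhammer_succ_eval, Nat.factorial_succ,
    Nat.cast_mul, mul_inv, div_eq_mul_inv, Nat.cast_add, Nat.cast_one]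
  ring

/-- The series terminates, with infinite radius, if `a` or `b` is a nonpositive integer; otherwise
the radius is exactly 1. -/
theorem one_le_ordinaryHypergeometricSeries_radius (a b : ℂ) {c : ℂ} (hc : ∀ k : ℕ, c + k ≠ 0) :
    1 ≤ (ordinaryHypergeometricSeries ℂ a b c).radius := by
  by_cases ha : ∃ k : ℕ, a = -k
  · obtain ⟨k, rfl⟩ := ha
    rw [ordinaryHypergeometric_radius_top_of_neg_nat₁]
    exact le_top
  by_cases hb : ∃ k : ℕ, b = -k
  · obtain ⟨k, rfl⟩ := hb
    rw [ordinaryHypergeometric_radius_top_of_neg_nat₂]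
    exact le_top
  push Not at ha hb
  rw [ordinaryHypergeometricSeries_radius_eq_one]
  refine fun k => ⟨fun h => ha k ?_, fun h => hb k ?_, fun h => hc k ?_⟩
  · rw [h, neg_neg]
  · rw [h, neg_neg]
  · rw [h]; ring

theorem mem_eball_zero_one {w : ℂ} (hw : ‖w‖ < 1) : w ∈ Metric.eball (0 : ℂ) 1 := by
  simpa [← ENNReal.ofReal_one, Metric.eball_ofReal] using hw

theorem hasSum_ordinaryHypergeometric (a b : ℂ) {c w : ℂ} (hc : ∀ k : ℕ, c + k ≠ 0)
    (hw : ‖w‖ < 1) :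
    HasSum (fun n => ordinaryHypergeometricCoefficient a b c n * w ^ n) (₂F₁ a b c w) := by
  have h := (ordinaryHypergeometricSeries ℂ a b c).hasSum (x := w)
    (Metric.eball_subset_eball (one_le_ordinaryHypergeometricSeries_radius a b hc)
      (mem_eball_zero_one hw))
  rw [ordinaryHypergeometricSeries_apply_eq'] at h
  exact h

theorem differentiableOn_ordinaryHypergeometric (a b : ℂ) {c : ℂ} (hc : ∀ k : ℕ, c + k ≠ 0) :
    DifferentiableOn ℂ (₂F₁ a b c : ℂ → ℂ) (Metric.ball 0 1) := by
  have h1 := one_le_ordinaryHypergeometricSeries_radius a b hc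
  have h := ((ordinaryHypergeometricSeries ℂ a b c).hasFPowerSeriesOnBall
    (zero_lt_one.trans_le h1)).differentiableOn.mono (Metric.eball_subset_eball h1)
  rwa [← ENNReal.ofReal_one, Metric.eball_ofReal] at h

theorem add_natCast_ne_zero_succ {c : ℂ} (hc : ∀ k : ℕ, c + k ≠ 0) (k : ℕ) : c + 1 + k ≠ 0 := by
  have := hc (k + 1)
  push_cast at this
  rwa [add_assoc, add_comm (1 : ℂ)]

/-- Contiguous relation between `₂F₁ a b c`, `₂F₁ a b (c + 1)` and `₂F₁ a (b + 1) (c + 1)`. -/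
theorem ordinaryHypergeometric_contiguous_lower (a b : ℂ) {c w : ℂ} (hc : ∀ k : ℕ, c + k ≠ 0)
    (hw : ‖w‖ < 1) :
    c * ₂F₁ a b c w - (c - b) * ₂F₁ a b (c + 1) w = b * ₂F₁ a (b + 1) (c + 1) w := by
  have hc' := add_natCast_ne_zero_succ hc
  refine (((hasSum_ordinaryHypergeometric a b hc hw).mul_left c).sub
    ((hasSum_ordinaryHypergeometric a b hc' hw).mul_left (c - b))).unique ?_
  refine ((hasSum_ordinaryHypergeometric a (b + 1) hc' hw).mul_left b).of_eq fun n => ?_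
  have e1 := ascPochhammer_eval_add_one_mul c n
  have e2 := ascPochhammer_eval_add_one_mul b n
  have h1 := ascPochhammer_eval_ne_zero hc n
  have h2 := ascPochhammer_eval_ne_zero hc' n
  have h3 : (n.factorial : ℂ) ≠ 0 := by exact_mod_cast n.factorial_ne_zero
  simp only [ordinaryHypergeometricCoefficient]
  field_simp
  linear_combination (Polynomial.eval a (ascPochhammer ℂ n)) * w ^ n *
    ((Polynomial.eval b (ascPochhammer ℂ n)) * e1 - (Polynomial.eval c (ascPochhammer ℂ n)) * e2)

/-- Contiguous relation between `₂F₁ (a + 1) b c`, `₂F₁ a b c` and `₂F₁ (a + 1) b (c + 1)`. -/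
theorem ordinaryHypergeometric_contiguous_upper (a b : ℂ) {c w : ℂ} (hc : ∀ k : ℕ, c + k ≠ 0)
    (hw : ‖w‖ < 1) :
    (1 - w) * ₂F₁ (a + 1) b c w - ₂F₁ a b c w =
      -((c - b) / c) * w * ₂F₁ (a + 1) b (c + 1) w := by
  have hc' := add_natCast_ne_zero_succ hc
  have s1 := hasSum_ordinaryHypergeometric (a + 1) b hc hw
  have s2 := hasSum_ordinaryHypergeometric a b hc hw
  have s3 := hasSum_ordinaryHypergeometric (a + 1) b hc' hw
  -- The constant terms of the two series cancel; after a shift by one index the difference is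
  -- aligned with `w` times the first series.
  have s4 := ((hasSum_nat_add_iff' 1).2 (s1.sub s2)).sub (s1.mul_left w)
  have e := s4.unique (a₂ := -((c - b) / c) * w * ₂F₁ (a + 1) b (c + 1) w) ?_
  · rw [← e]
    simp [ordinaryHypergeometricCoefficient, ascPochhammer_zero]
    ring
  refine (s3.mul_left (-((c - b) / c) * w)).of_eq fun n => ?_
  have e1 := ascPochhammer_eval_add_one_mul c n
  have e2 := ascPochhammer_eval_add_one_mul a n
  have h1 := ascPochhammer_eval_ne_zero hc n
  have h2 := ascPochhammer_eval_ne_zero hc' n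
  have h3 : (n.factorial : ℂ) ≠ 0 := by exact_mod_cast n.factorial_ne_zero
  have h4 := hc n
  have h5 : c ≠ 0 := by simpa using hc 0
  have h6 : (n : ℂ) + 1 ≠ 0 := by exact_mod_cast n.succ_ne_zero
  simp only [ordinaryHypergeometricCoefficient_succ]
  simp only [ordinaryHypergeometricCoefficient]
  have e3 : (Polynomial.eval (c + 1) (ascPochhammer ℂ n))⁻¹ =
      c * (Polynomial.eval c (ascPochhammer ℂ n))⁻¹ / (c + n) := by
    field_simp
    linear_combination -e1
  rw [e3]
  field_simp
  linear_combination (b + n) * (Polynomial.eval b (ascPochhammer ℂ n)) * w ^ (n + 1) * e2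

/-! ### Pfaff's transformation and continuation to the half-plane Re z < 1/2 -/

/-- The Chu–Vandermonde identity. Pascal's rule reduces `N + 1` with `(c, d)` to `N` with `(c, d)`
and with `(c + 1, d + 1)`, which have the same difference `c - d`; hence the induction is over all
`c` and `d`. -/
theorem sum_choose_mul_ascPochhammer_div (N : ℕ) : ∀ {c : ℂ} (d : ℂ), (∀ k : ℕ, c + k ≠ 0) →
    ∑ ij ∈ Finset.HasAntidiagonal.antidiagonal N, (N.choose ij.1 : ℂ) * ((-1) ^ ij.1 *
      (ascPochhammer ℂ ij.1).eval d / (ascPochhammer ℂ ij.1).eval c) =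
      (ascPochhammer ℂ N).eval (c - d) / (ascPochhammer ℂ N).eval c := by
  induction N with
  | zero => intro c d hc; simp [ascPochhammer_zero]
  | succ N ih =>
    intro c d hc
    have hc' := add_natCast_ne_zero_succ hc
    have h0 : c ≠ 0 := by simpa using hc 0
    rw [Finset.sum_antidiagonal_choose_succ_mul (fun i _ => (-1) ^ i *
      (ascPochhammer ℂ i).eval d / (ascPochhammer ℂ i).eval c), ih d hc]
    have e : ∑ ij ∈ Finset.HasAntidiagonal.antidiagonal N,
        (N.choose ij.2 : ℂ) * ((-1) ^ (ij.1 + 1) *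
        (ascPochhammer ℂ (ij.1 + 1)).eval d / (ascPochhammer ℂ (ij.1 + 1)).eval c) =
        -(d / c) * ((ascPochhammer ℂ N).eval (c + 1 - (d + 1)) /
          (ascPochhammer ℂ N).eval (c + 1)) := by
      rw [← ih (d + 1) hc', Finset.mul_sum]
      refine Finset.sum_congr rfl fun ij hij => ?_
      rw [Finset.HasAntidiagonal.mem_antidiagonal] at hij
      rw [Nat.choose_symm_of_eq_add (a := ij.1) (b := ij.2) hij.symm, ascPochhammer_succ_eval,
        ascPochhammer_succ_eval, ← ascPochhammer_eval_add_one_mul,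
        ← ascPochhammer_eval_add_one_mul]
      have := ascPochhammer_eval_ne_zero hc' ij.1
      field_simp
      ring
    rw [e, add_sub_add_right_eq_sub]
    have h1 := ascPochhammer_eval_ne_zero hc N
    have h2 := ascPochhammer_eval_ne_zero hc' N
    have h3 := hc N
    have e1 := ascPochhammer_eval_add_one_mul c N
    rw [ascPochhammer_succ_eval, ascPochhammer_succ_eval]
    have e2 : (ascPochhammer ℂ N).eval (c + 1) = (ascPochhammer ℂ N).eval c * (c + N) / c := by
      field_simp
      linear_combination e1
    rw [e2]
    field_simp
    ring

theorem hasSum_one_sub_cpow_neg (a : ℂ) {z : ℂ} (hz : ‖z‖ < 1) :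
    HasSum (fun m : ℕ => (ascPochhammer ℂ m).eval a / m.factorial * z ^ m) ((1 - z) ^ (-a)) := by
  have h := (Complex.one_add_cpow_hasFPowerSeriesOnBall_zero (a := -a)).hasSum
    (y := -z) (mem_eball_zero_one (by simpa using hz))
  rw [binomialSeries_eq_ordinaryHypergeometricSeries (b := (1 : ℂ))] at h
  · simp only [zero_add] at h
    rw [← sub_eq_add_neg] at h
    refine h.of_eq fun m => ?_
    rw [FormalMultilinearSeries.compContinuousLinearMap_apply]
    simp only [Function.comp_def, neg_apply, ContinuousLinearMap.id_apply, neg_neg]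
    rw [ordinaryHypergeometricSeries_apply_eq, ascPochhammer_eval_one, smul_eq_mul]
    have h3 : (m.factorial : ℂ) ≠ 0 := by exact_mod_cast m.factorial_ne_zero
    field_simp
  · intro k hk
    have : ((k + 1 : ℕ) : ℂ) = 0 := by push_cast; rw [hk]; ring
    exact Nat.succ_ne_zero k (by exact_mod_cast this)

/-- The numerator is dominated by the rising factorial of `N + 1`, which is `m!` times a binomial
coefficient. -/
theorem norm_ascPochhammer_div_factorial_le (a : ℂ) (N m : ℕ) (h : ‖a‖ ≤ N + 1) :
    ‖(ascPochhammer ℂ m).eval a / m.factorial‖ ≤ 2 ^ (N + m) := by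
  have h1 : ‖(ascPochhammer ℂ m).eval a‖ ≤ (ascPochhammer ℝ m).eval ((N + 1 : ℕ) : ℝ) := by
    induction m with
    | zero => simp [ascPochhammer_zero]
    | succ m ih =>
      rw [ascPochhammer_succ_eval, ascPochhammer_succ_eval, norm_mul]
      refine mul_le_mul ih ?_ (norm_nonneg _) ((norm_nonneg _).trans ih)
      refine (norm_add_le _ _).trans ?_
      rw [Complex.norm_natCast]
      push_cast
      linarith
  rw [ascPochhammer_nat_eq_natCast_ascFactorial,
    Nat.ascFactorial_eq_factorial_mul_choose] at h1
  have h3 : (0 : ℝ) < m.factorial := by exact_mod_cast m.factorial_pos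
  rw [norm_div, Complex.norm_natCast, div_le_iff₀ h3]
  refine h1.trans ?_
  have := Nat.choose_le_two_pow (N + m) m
  push_cast
  rw [mul_comm]
  gcongr
  exact_mod_cast this

/-- Absolute convergence for the rearrangement in Pfaff's transformation: the terms are at most a
constant times (4‖z‖)^k (2‖z‖)^l. A radius of 1/4 would do for this bound. -/
theorem summable_mul_ascPochhammer_div_factorial (a : ℂ) {z : ℂ} (hz : ‖z‖ < 1 / 8) {T : ℕ → ℂ}
    {C : ℝ} (hC : ∀ k, ‖T k‖ ≤ C * 2 ^ k) :
    Summable fun p : ℕ × ℕ => T p.1 * (-z) ^ p.1 *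
      ((ascPochhammer ℂ p.2).eval (a + p.1) / p.2.factorial * z ^ p.2) := by
  have hC0 : 0 ≤ C := by simpa using (norm_nonneg _).trans (hC 0)
  obtain ⟨N, hN⟩ := exists_nat_ge ‖a‖
  have g1 : Summable fun k : ℕ => (4 * ‖z‖) ^ k :=
    summable_geometric_of_lt_one (by positivity) (by linarith)
  have g2 : Summable fun k : ℕ => (2 * ‖z‖) ^ k :=
    summable_geometric_of_lt_one (by positivity) (by linarith)
  refine Summable.of_norm_bounded ((g1.mul_of_nonneg g2 (fun k => by positivity)
    (fun k => by positivity)).mul_left (C * 2 ^ N)) fun p => ?_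
  have hp : ‖a + p.1‖ ≤ ((N + p.1 : ℕ) : ℝ) + 1 := by
    refine (norm_add_le _ _).trans ?_
    rw [Complex.norm_natCast]
    push_cast
    linarith
  have hP := norm_ascPochhammer_div_factorial_le _ _ p.2 hp
  rw [norm_mul, norm_mul, norm_mul, norm_pow, norm_pow, norm_neg]
  calc _ ≤ C * 2 ^ p.1 * ‖z‖ ^ p.1 * (2 ^ (N + p.1 + p.2) * ‖z‖ ^ p.2) := by
        gcongr
        exact hC _
    _ = _ := by
        rw [mul_pow, mul_pow, pow_add, pow_add, show (4 : ℝ) = 2 * 2 by norm_num, mul_pow]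
        ring

/-- The terms of the series at `1 / 2` tend to zero, hence are bounded. -/
theorem ordinaryHypergeometricCoefficient_norm_le (a b : ℂ) {c : ℂ} (hc : ∀ k : ℕ, c + k ≠ 0) :
    ∃ C : ℝ, ∀ k, ‖ordinaryHypergeometricCoefficient a b c k‖ ≤ C * 2 ^ k := by
  obtain ⟨C, hC⟩ := (hasSum_ordinaryHypergeometric a b hc
    (w := (1 / 2 : ℂ)) (by norm_num)).summable.tendsto_atTop_zero.norm.bddAbove_range
  refine ⟨C, fun k => ?_⟩
  have h := hC ⟨k, rfl⟩
  dsimp only at h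
  rw [norm_mul, norm_pow, norm_div, norm_one, Complex.norm_ofNat, one_div, inv_pow,
    ← div_eq_mul_inv, div_le_iff₀ (by positivity)] at h
  exact h

theorem sum_antidiagonal_ordinaryHypergeometricCoefficient (a b : ℂ) {c : ℂ}
    (hc : ∀ k : ℕ, c + k ≠ 0) (n : ℕ) :
    ∑ p ∈ Finset.HasAntidiagonal.antidiagonal n,
      ordinaryHypergeometricCoefficient a (c - b) c p.1 * (-1) ^ p.1 *
        ((ascPochhammer ℂ p.2).eval (a + p.1) / p.2.factorial) =
      ordinaryHypergeometricCoefficient a b c n := by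
  have h := sum_choose_mul_ascPochhammer_div n (c - b) hc
  rw [sub_sub_cancel] at h
  have h3 : (n.factorial : ℂ) ≠ 0 := by exact_mod_cast n.factorial_ne_zero
  trans (ascPochhammer ℂ n).eval a / n.factorial *
    ((ascPochhammer ℂ n).eval b / (ascPochhammer ℂ n).eval c)
  · rw [← h, Finset.mul_sum]
    refine Finset.sum_congr rfl fun p hp => ?_
    rw [Finset.HasAntidiagonal.mem_antidiagonal] at hp
    subst hp
    rw [← ascPochhammer_eval_mul_eval_add, Nat.choose_symm_add, Nat.add_choose,
      Nat.cast_div_charZero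
      (Nat.factorial_mul_factorial_dvd_factorial_add _ _), ordinaryHypergeometricCoefficient]
    have h4 : (p.1.factorial : ℂ) ≠ 0 := by exact_mod_cast p.1.factorial_ne_zero
    have h5 : (p.2.factorial : ℂ) ≠ 0 := by exact_mod_cast p.2.factorial_ne_zero
    have h6 := ascPochhammer_eval_ne_zero hc p.1
    push_cast
    field_simp
  · rw [ordinaryHypergeometricCoefficient]
    field_simp

/-- Pfaff's transformation near the origin. -/
theorem ordinaryHypergeometric_pfaff (a b : ℂ) {c z : ℂ} (hc : ∀ k : ℕ, c + k ≠ 0)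
    (hz : ‖z‖ < 1 / 8) :
    ₂F₁ a b c z = (1 - z) ^ (-a) * ₂F₁ a (c - b) c (z / (z - 1)) := by
  have hz1 : ‖z‖ < 1 := hz.trans (by norm_num)
  have hz0 : 1 - z ≠ 0 := by
    intro h
    rw [sub_eq_zero] at h
    rw [← h] at hz1
    simp at hz1
  have hw : ‖z / (z - 1)‖ < 1 := by
    rw [norm_div, div_lt_one (norm_pos_iff.2 (by rwa [Ne, ← neg_eq_zero, neg_sub]))]
    have := norm_sub_norm_le (1 : ℂ) z
    rw [norm_one, norm_sub_rev] at this
    linarith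
  obtain ⟨C, hC⟩ := ordinaryHypergeometricCoefficient_norm_le a (c - b) hc
  have hsum := summable_mul_ascPochhammer_div_factorial a hz hC
  -- Since (1-z)^(-a) (z/(z-1))^k = (-z)^k (1-z)^(-a-k), expanding the last power gives a double
  -- series. Summed along rows it is the right-hand side; summed along diagonals it is the left-hand
  -- side, by Chu–Vandermonde.
  have h1 := (hsum.hasSum.prod_fiberwise fun k => (hasSum_one_sub_cpow_neg (a + k) hz1).mul_left
    (ordinaryHypergeometricCoefficient a (c - b) c k * (-z) ^ k)).unique
      (((hasSum_ordinaryHypergeometric a (c - b) hc hw).mul_left ((1 - z) ^ (-a))).of_eq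
        fun k => ?_)
  · rw [← h1, ← Finset.HasAntidiagonal.sigmaAntidiagonalEquivProd.tsum_eq]
    have hs2 := Finset.HasAntidiagonal.sigmaAntidiagonalEquivProd.summable_iff.2 hsum
    refine (hasSum_ordinaryHypergeometric a b hc hz1).unique
      ((hs2.hasSum.sigma fun n => hasSum_fintype _).of_eq fun n => ?_)
    rw [← sum_antidiagonal_ordinaryHypergeometricCoefficient a b hc n, Finset.sum_mul,
      ← Finset.sum_coe_sort]
    refine Finset.sum_congr rfl fun p _ => ?_
    obtain ⟨p, hp⟩ := p
    rw [Finset.HasAntidiagonal.mem_antidiagonal] at hp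
    subst hp
    simp only [Function.comp_apply, Finset.HasAntidiagonal.sigmaAntidiagonalEquivProd_apply]
    rw [pow_add, neg_pow z]
    ring
  · rw [neg_add, Complex.cpow_add _ _ hz0, Complex.cpow_neg _ (k : ℂ), Complex.cpow_natCast,
      show z / (z - 1) = -z / (1 - z) by rw [← neg_sub 1 z, div_neg, neg_div], div_pow]
    ring

/-- The half-plane consists of the points closer to 0 than to 1. -/
theorem norm_div_sub_one_lt_one {z : ℂ} (hz : z.re < 1 / 2) : ‖z / (z - 1)‖ < 1 := by
  have h1 : z - 1 ≠ 0 := by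
    intro h
    rw [sub_eq_zero] at h
    norm_num [h] at hz
  rw [norm_div, div_lt_one (norm_pos_iff.2 h1), ← sq_lt_sq₀ (norm_nonneg _) (norm_nonneg _),
    ← Complex.normSq_eq_norm_sq, ← Complex.normSq_eq_norm_sq, Complex.normSq_apply,
    Complex.normSq_apply]
  simp
  nlinarith

/-- Pfaff's right-hand side is holomorphic on this convex half-plane about 0, because `1 - z` stays
in the right half-plane and `z / (z - 1)` in the unit disc; near 0 it agrees with the series. -/
theorem isGaussValue_pfaff (a b : ℂ) {c z : ℂ} (hc : ∀ k : ℕ, c + k ≠ 0) (hz : z.re < 1 / 2) :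
    IsGaussValue a b c z ((1 - z) ^ (-a) * ₂F₁ a (c - b) c (z / (z - 1))) := by
  have hcv : Convex ℝ {z : ℂ | z.re < 1 / 2} := convex_halfSpace_re_lt (1 / 2)
  refine ⟨{z : ℂ | z.re < 1 / 2}, fun z => (1 - z) ^ (-a) * ₂F₁ a (c - b) c (z / (z - 1)),
    isOpen_lt Complex.continuous_re continuous_const, hcv.starConvex (by simp), hz, ?_, ?_, rfl⟩
  · intro u hu
    have hu : u.re < 1 / 2 := hu
    have h1 : u - 1 ≠ 0 := by
      intro h
      rw [sub_eq_zero] at h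
      norm_num [h] at hu
    refine DifferentiableAt.differentiableWithinAt (DifferentiableAt.mul ?_ ?_)
    · refine DifferentiableAt.cpow (by fun_prop) (by fun_prop) (Or.inl ?_)
      simp only [Complex.sub_re, Complex.one_re]
      linarith
    · refine DifferentiableAt.comp (g := (₂F₁ a (c - b) c : ℂ → ℂ)) u ?_
        (differentiableAt_id.div (by fun_prop) h1)
      refine (differentiableOn_ordinaryHypergeometric a (c - b) hc).differentiableAt
        (Metric.isOpen_ball.mem_nhds ?_)
      simpa using norm_div_sub_one_lt_one hu
  · filter_upwards [Metric.ball_mem_nhds (0 : ℂ) (by norm_num : (0 : ℝ) < 1 / 8)] with u hu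
    exact (ordinaryHypergeometric_pfaff a b hc (by simpa using hu)).symm

theorem gauss2F1_pfaff (a b : ℂ) {c z : ℂ} (hc : ∀ k : ℕ, c + k ≠ 0) (hz : z.re < 1 / 2) :
    gauss2F1 a b c z = (1 - z) ^ (-a) * ₂F₁ a (c - b) c (z / (z - 1)) :=
  (isGaussValue_pfaff a b hc hz).gauss2F1_eq

/-- Under Pfaff's transformation all three terms carry the factor (1-z)^(-a), and what remains is
the series relation with `c - b` in place of `b`. -/
theorem gauss2F1_contiguous_lower (a b : ℂ) {c z : ℂ} (hc : ∀ k : ℕ, c + k ≠ 0)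
    (hz : z.re < 1 / 2) :
    c * gauss2F1 a b c z - b * gauss2F1 a (b + 1) (c + 1) z =
      (c - b) * gauss2F1 a b (c + 1) z := by
  have hc' := add_natCast_ne_zero_succ hc
  rw [gauss2F1_pfaff a b hc hz, gauss2F1_pfaff _ _ hc' hz, gauss2F1_pfaff _ _ hc' hz,
    add_sub_add_right_eq_sub, show c + 1 - b = c - b + 1 by ring]
  have h := ordinaryHypergeometric_contiguous_lower a (c - b) hc (norm_div_sub_one_lt_one hz)
  linear_combination (1 - z) ^ (-a) * h

/-- The terms with `a + 1` carry an extra Pfaff factor 1/(1-z), which equals 1 - w for w = z/(z-1);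
this is the factor in the series relation. -/
theorem gauss2F1_contiguous_upper (a b : ℂ) {c z : ℂ} (hc : ∀ k : ℕ, c + k ≠ 0)
    (hz : z.re < 1 / 2) :
    gauss2F1 (a + 1) b c z - gauss2F1 a b c z =
      b * z / c * gauss2F1 (a + 1) (b + 1) (c + 1) z := by
  have hc' := add_natCast_ne_zero_succ hc
  have hc0 : c ≠ 0 := by simpa using hc 0
  have h1 : 1 - z ≠ 0 := by
    intro h
    rw [sub_eq_zero] at h
    norm_num [← h] at hz
  rw [gauss2F1_pfaff _ b hc hz, gauss2F1_pfaff _ _ hc' hz, gauss2F1_pfaff _ _ hc hz,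
    add_sub_add_right_eq_sub]
  have h := ordinaryHypergeometric_contiguous_upper a (c - b) hc (norm_div_sub_one_lt_one hz)
  rw [neg_add, Complex.cpow_add _ _ h1, Complex.cpow_neg_one]
  rw [sub_sub_cancel, show z / (z - 1) = -z / (1 - z) by
    rw [← neg_sub 1 z, div_neg, neg_div]] at *
  have e : 1 - -z / (1 - z) = (1 - z)⁻¹ := by field_simp; ring
  rw [e] at h
  linear_combination (1 - z) ^ (-a) * h

/-! ### Elimination of the dual lattice -/

/-- The equations of the model on the lattice `ℤ²`, after elimination of the dual lattice. -/
structure IsLatticeField (κ μ δ : ℝ) (a : (ℤ → ℤ → ℂ) × (ℤ → ℤ → ℂ)) : Prop where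
  fst : ∀ j n : ℤ, a.1 j n = κ * (a.1 (j + 1) (n - 1) - Complex.I * δ * a.2 (j + 1) (n - 1) +
    μ * (a.2 j (n - 1) + Complex.I * δ * a.1 j (n - 1)))
  snd : ∀ j n : ℤ, a.2 j n = κ * (a.2 (j - 1) (n - 1) + Complex.I * δ * a.1 (j - 1) (n - 1) -
    μ * (a.1 j (n - 1) - Complex.I * δ * a.2 j (n - 1))) +
      2 * (if j = 0 then 1 else 0) * (if n = 0 then 1 else 0)

section Reduction

variable {ε : ℝ}

theorem isEvenPoint_mul (hε : ε ≠ 0) (j n : ℤ) : IsEvenPoint ε (ε * j) (ε * n) :=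
  ⟨2 * j, 2 * n, even_two_mul j, even_two_mul n, by push_cast; field_simp, by push_cast; field_simp⟩

theorem isOddPoint_mul_add (hε : ε ≠ 0) (j n : ℤ) :
    IsOddPoint ε (ε * j + ε / 2) (ε * n + ε / 2) :=
  ⟨2 * j + 1, 2 * n + 1, ⟨j, rfl⟩, ⟨n, rfl⟩, by push_cast; field_simp, by push_cast; field_simp⟩

theorem IsEvenPoint.exists_eq (hε : ε ≠ 0) {x t : ℝ} (h : IsEvenPoint ε x t) :
    ∃ j n : ℤ, x = ε * j ∧ t = ε * n := by
  obtain ⟨a, b, ⟨j, rfl⟩, ⟨n, rfl⟩, hx, ht⟩ := h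
  refine ⟨j, n, ?_, ?_⟩
  · rw [div_eq_iff hε] at hx; push_cast at hx; linarith
  · rw [div_eq_iff hε] at ht; push_cast at ht; linarith

theorem IsOddPoint.exists_eq (hε : ε ≠ 0) {x t : ℝ} (h : IsOddPoint ε x t) :
    ∃ j n : ℤ, x = ε * j + ε / 2 ∧ t = ε * n + ε / 2 := by
  obtain ⟨a, b, ⟨j, rfl⟩, ⟨n, rfl⟩, hx, ht⟩ := h
  refine ⟨j, n, ?_, ?_⟩
  · rw [div_eq_iff hε] at hx; push_cast at hx; linarith
  · rw [div_eq_iff hε] at ht; push_cast at ht; linarith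

theorem IsEvenPoint.not_isOddPoint {x t : ℝ} (h : IsEvenPoint ε x t) : ¬ IsOddPoint ε x t := by
  obtain ⟨a, b, ha, hb, hx, ht⟩ := h
  rintro ⟨a', b', ha', hb', hx', ht'⟩
  have : a = a' := by exact_mod_cast hx.symm.trans hx'
  subst this
  exact (Int.not_even_iff_odd.2 ha') ha

theorem isLatticePoint_iff {x t : ℝ} :
    IsLatticePoint ε x t ↔ IsEvenPoint ε x t ∨ IsOddPoint ε x t := by
  constructor
  · rintro ⟨a, b, c, hx, ht, hc⟩
    have h : a + b = 2 * c := by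
      have : (a : ℝ) + b = 2 * c := by rw [← hx, ← ht, ← hc]; ring
      exact_mod_cast this
    rcases Int.even_or_odd a with ha | ha
    · exact Or.inl ⟨a, b, ha, (Int.even_add.1 (h ▸ even_two_mul c)).1 ha, hx, ht⟩
    · exact Or.inr ⟨a, b, ha, (Int.even_add'.1 (h ▸ even_two_mul c)).1 ha, hx, ht⟩
  · rintro (⟨a, b, ha, hb, hx, ht⟩ | ⟨a, b, ha, hb, hx, ht⟩)
    · obtain ⟨c, hc⟩ := ha.add hb
      refine ⟨a, b, c, hx, ht, ?_⟩
      have : (a : ℝ) + b = c + c := by exact_mod_cast hc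
      rw [← hx, ← ht] at this
      linear_combination this / 2
    · obtain ⟨c, hc⟩ := ha.add_odd hb
      refine ⟨a, b, c, hx, ht, ?_⟩
      have : (a : ℝ) + b = c + c := by exact_mod_cast hc
      rw [← hx, ← ht] at this
      linear_combination this / 2

/-- The restriction of a pair of functions on the plane to the lattice with step `ε`. -/
def latticeRestrict (ε : ℝ) (A : (ℝ → ℝ → ℂ) × (ℝ → ℝ → ℂ)) :
    (ℤ → ℤ → ℂ) × (ℤ → ℤ → ℂ) :=
  (fun j n => A.1 (ε * j) (ε * n), fun j n => A.2 (ε * j) (ε * n))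

variable {m δ : ℝ} {A B : (ℝ → ℝ → ℂ) × (ℝ → ℝ → ℂ)}

theorem IsAnticheckersField.odd_eq (hε : ε ≠ 0) (h : IsAnticheckersField m ε δ A) (j n : ℤ) :
    A.1 (ε * j + ε / 2) (ε * n + ε / 2) = 1 / (√(1 - δ ^ 2) : ℂ) *
      (A.1 (ε * (j + 1 : ℤ)) (ε * n) - Complex.I * δ * A.2 (ε * (j + 1 : ℤ)) (ε * n)) ∧
    A.2 (ε * j + ε / 2) (ε * n + ε / 2) = 1 / (√(1 - δ ^ 2) : ℂ) *
      (A.2 (ε * j) (ε * n) + Complex.I * δ * A.1 (ε * j) (ε * n)) := by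
  have h2 := h.axiom_two _ _ (isOddPoint_mul_add hε j n)
  rw [show ε * j + ε / 2 + ε / 2 = ε * (j + 1 : ℤ) by push_cast; ring,
    show ε * n + ε / 2 - ε / 2 = ε * n by ring, show ε * j + ε / 2 - ε / 2 = ε * j by ring] at h2
  exact h2

theorem IsAnticheckersField.isLatticeField (hε : ε ≠ 0) (h : IsAnticheckersField m ε δ A) :
    IsLatticeField (1 / √(1 + m ^ 2 * ε ^ 2) * (1 / √(1 - δ ^ 2))) (m * ε) δ
      (latticeRestrict ε A) := by
  have key := fun j n : ℤ => h.axiom_one _ _ (isEvenPoint_mul hε j n)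
  have e1 : ∀ n : ℤ, ε * n - ε / 2 = ε * (n - 1 : ℤ) + ε / 2 := fun n => by push_cast; ring
  constructor
  · intro j n
    have h1 := (key j n).1
    rw [e1, (h.odd_eq hε j (n - 1)).1, (h.odd_eq hε j (n - 1)).2] at h1
    simp only [latticeRestrict]
    rw [h1]
    push_cast
    ring
  · intro j n
    have h1 := (key j n).2
    rw [e1, e1, (h.odd_eq hε (j - 1) (n - 1)).1, (h.odd_eq hε (j - 1) (n - 1)).2,
      sub_add_cancel] at h1
    simp only [latticeRestrict]
    rw [h1]
    simp only [mul_eq_zero, hε, false_or, Int.cast_eq_zero]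
    push_cast
    ring

/-- Axiom 2 computes the values on the dual lattice from those on the lattice, and elsewhere fields
vanish. -/
theorem IsAnticheckersField.ext_of_latticeRestrict_eq (hε : ε ≠ 0)
    (hA : IsAnticheckersField m ε δ A) (hB : IsAnticheckersField m ε δ B)
    (h : latticeRestrict ε A = latticeRestrict ε B) : A = B := by
  have h1 : ∀ j n : ℤ, A.1 (ε * j) (ε * n) = B.1 (ε * j) (ε * n) := fun j n =>
    congrFun (congrFun (congrArg Prod.fst h) j) n
  have h2 : ∀ j n : ℤ, A.2 (ε * j) (ε * n) = B.2 (ε * j) (ε * n) := fun j n =>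
    congrFun (congrFun (congrArg Prod.snd h) j) n
  have key : ∀ x t, A.1 x t = B.1 x t ∧ A.2 x t = B.2 x t := by
    intro x t
    by_cases hl : IsLatticePoint ε x t
    · rcases isLatticePoint_iff.1 hl with he | ho
      · obtain ⟨j, n, rfl, rfl⟩ := he.exists_eq hε
        exact ⟨h1 j n, h2 j n⟩
      · obtain ⟨j, n, rfl, rfl⟩ := ho.exists_eq hε
        rw [(hA.odd_eq hε j n).1, (hA.odd_eq hε j n).2, (hB.odd_eq hε j n).1,
          (hB.odd_eq hε j n).2]
        simp only [h1, h2, and_self]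
    · rw [(hA.support x t hl).1, (hA.support x t hl).2, (hB.support x t hl).1,
        (hB.support x t hl).2]
      exact ⟨rfl, rfl⟩
  exact Prod.ext (funext fun x => funext fun t => (key x t).1)
    (funext fun x => funext fun t => (key x t).2)

open scoped Classical in
/-- The extension of a pair of functions on the lattice to the dual lattice and, by zero,
to the plane. -/
noncomputable def latticeExtend (ε δ : ℝ) (a : (ℤ → ℤ → ℂ) × (ℤ → ℤ → ℂ)) :
    (ℝ → ℝ → ℂ) × (ℝ → ℝ → ℂ) :=
  (fun x t => if IsEvenPoint ε x t then a.1 ⌊x / ε⌋ ⌊t / ε⌋ else if IsOddPoint ε x t then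
      1 / (√(1 - δ ^ 2) : ℂ) * (a.1 (⌊x / ε⌋ + 1) ⌊t / ε⌋ -
        Complex.I * δ * a.2 (⌊x / ε⌋ + 1) ⌊t / ε⌋) else 0,
    fun x t => if IsEvenPoint ε x t then a.2 ⌊x / ε⌋ ⌊t / ε⌋ else if IsOddPoint ε x t then
      1 / (√(1 - δ ^ 2) : ℂ) * (a.2 ⌊x / ε⌋ ⌊t / ε⌋ + Complex.I * δ * a.1 ⌊x / ε⌋ ⌊t / ε⌋) else 0)

theorem latticeExtend_even (hε : ε ≠ 0) (a : (ℤ → ℤ → ℂ) × (ℤ → ℤ → ℂ)) (j n : ℤ) :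
    (latticeExtend ε δ a).1 (ε * j) (ε * n) = a.1 j n ∧
    (latticeExtend ε δ a).2 (ε * j) (ε * n) = a.2 j n := by
  simp [latticeExtend, isEvenPoint_mul hε, mul_div_cancel_left₀ _ hε]

theorem floor_mul_add_half_div (hε : ε ≠ 0) (j : ℤ) : ⌊(ε * j + ε / 2) / ε⌋ = j := by
  rw [show (ε * j + ε / 2) / ε = (j : ℝ) + 1 / 2 by field_simp, Int.floor_intCast_add]
  norm_num

theorem latticeExtend_odd (hε : ε ≠ 0) (a : (ℤ → ℤ → ℂ) × (ℤ → ℤ → ℂ)) (j n : ℤ) :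
    (latticeExtend ε δ a).1 (ε * j + ε / 2) (ε * n + ε / 2) =
      1 / (√(1 - δ ^ 2) : ℂ) * (a.1 (j + 1) n - Complex.I * δ * a.2 (j + 1) n) ∧
    (latticeExtend ε δ a).2 (ε * j + ε / 2) (ε * n + ε / 2) =
      1 / (√(1 - δ ^ 2) : ℂ) * (a.2 j n + Complex.I * δ * a.1 j n) := by
  have h1 := isOddPoint_mul_add hε j n
  have h2 : ¬ IsEvenPoint ε (ε * j + ε / 2) (ε * n + ε / 2) := fun h => h.not_isOddPoint h1
  simp only [latticeExtend, h1, h2, floor_mul_add_half_div hε, if_true, if_false, and_self]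

theorem isAnticheckersField_latticeExtend (hε : ε ≠ 0) {a : (ℤ → ℤ → ℂ) × (ℤ → ℤ → ℂ)}
    (h : IsLatticeField (1 / √(1 + m ^ 2 * ε ^ 2) * (1 / √(1 - δ ^ 2))) (m * ε) δ a)
    (hs : Summable fun p : ℤ × ℤ => ‖a.1 p.1 p.2‖ ^ 2 + ‖a.2 p.1 p.2‖ ^ 2) :
    IsAnticheckersField m ε δ (latticeExtend ε δ a) := by
  have e1 : ∀ n : ℤ, ε * n - ε / 2 = ε * (n - 1 : ℤ) + ε / 2 := fun n => by push_cast; ring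
  refine ⟨?_, ?_, ?_, ?_⟩
  · intro x t hl
    rw [isLatticePoint_iff, not_or] at hl
    simp [latticeExtend, hl]
  · intro x t he
    obtain ⟨j, n, rfl, rfl⟩ := he.exists_eq hε
    rw [e1, e1, (latticeExtend_odd hε a j (n - 1)).1, (latticeExtend_odd hε a j (n - 1)).2,
      (latticeExtend_odd hε a (j - 1) (n - 1)).1, (latticeExtend_odd hε a (j - 1) (n - 1)).2,
      (latticeExtend_even hε a j n).1, (latticeExtend_even hε a j n).2, h.fst j n, h.snd j n]
    simp only [mul_eq_zero, hε, false_or, Int.cast_eq_zero]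
    push_cast
    constructor
    · ring
    · rw [sub_add_cancel]
      ring
  · intro x t ho
    obtain ⟨j, n, rfl, rfl⟩ := ho.exists_eq hε
    rw [show ε * j + ε / 2 + ε / 2 = ε * (j + 1 : ℤ) by push_cast; ring,
      show ε * n + ε / 2 - ε / 2 = ε * n by ring, show ε * j + ε / 2 - ε / 2 = ε * j by ring]
    simp only [latticeExtend_odd hε, latticeExtend_even hε, and_self]
  · simpa only [latticeExtend_even hε] using hs

end Reduction

/-! ### Uniqueness of square summable solutions -/

/-- Square summability of a function on the lattice `ℤ²`. -/
def SqSummable (u : ℤ → ℤ → ℂ) : Prop :=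
  Summable fun p : ℤ × ℤ => ‖u p.1 p.2‖ ^ 2

namespace SqSummable

variable {u v : ℤ → ℤ → ℂ}

theorem add (hu : SqSummable u) (hv : SqSummable v) :
    SqSummable fun j n => u j n + v j n := by
  refine Summable.of_nonneg_of_le (fun _ => sq_nonneg _) (fun p => ?_)
    ((Summable.add hu hv).mul_left 2)
  have h := norm_add_le (u p.1 p.2) (v p.1 p.2)
  calc _ ≤ (‖u p.1 p.2‖ + ‖v p.1 p.2‖) ^ 2 := by gcongr
    _ ≤ _ := by nlinarith [sq_nonneg (‖u p.1 p.2‖ - ‖v p.1 p.2‖)]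

theorem const_mul (c : ℂ) (hu : SqSummable u) : SqSummable fun j n => c * u j n := by
  simpa only [SqSummable, norm_mul, mul_pow] using Summable.mul_left (‖c‖ ^ 2) hu

theorem sub (hu : SqSummable u) (hv : SqSummable v) :
    SqSummable fun j n => u j n - v j n := by
  simpa [sub_eq_add_neg] using hu.add (hv.const_mul (-1))

theorem shift (hu : SqSummable u) (i k : ℤ) : SqSummable fun j n => u (j + i) (n + k) :=
  (Equiv.addRight ((i, k) : ℤ × ℤ)).summable_iff.2 hu

theorem summable_conj_mul (hu : SqSummable u) (hv : SqSummable v) :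
    Summable fun p : ℤ × ℤ => starRingEnd ℂ (u p.1 p.2) * v p.1 p.2 := by
  refine Summable.of_norm_bounded (Summable.add hu hv) fun p => ?_
  rw [norm_mul, RCLike.norm_conj]
  nlinarith [sq_nonneg (‖u p.1 p.2‖ - ‖v p.1 p.2‖), sq_nonneg ‖u p.1 p.2‖,
    sq_nonneg ‖v p.1 p.2‖]

/-- The inverse of a shift is its adjoint, so the quadratic form of their sum is a number plus its
conjugate, hence real. -/
theorem exists_hasSum_shift_add_shift (hu : SqSummable u) (i k : ℤ) :
    ∃ x : ℝ, HasSum (fun p : ℤ × ℤ => starRingEnd ℂ (u p.1 p.2) *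
      (u (p.1 + i) (p.2 + k) + u (p.1 - i) (p.2 - k))) x := by
  obtain ⟨X, hX⟩ := hu.summable_conj_mul (hu.shift i k)
  have hY := (Complex.hasSum_conj'.2 hX)
  have hZ := (Equiv.addRight ((-i, -k) : ℤ × ℤ)).hasSum_iff.2 hY
  refine ⟨2 * X.re, ?_⟩
  have e : ((2 * X.re : ℝ) : ℂ) = X + starRingEnd ℂ X := by
    rw [Complex.add_conj]
  rw [e]
  refine (hX.add hZ).of_eq fun p => ?_
  simp [← sub_eq_add_neg]
  ring

/-- The only square summable eigenfunction of the self-adjoint lattice wave operator with a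
nonzero purely imaginary eigenvalue is zero. -/
theorem eq_zero_of_wave {κ β : ℝ} (hβ : β ≠ 0) (hu : SqSummable u)
    (h : ∀ j n : ℤ, u j (n + 1) + u j (n - 1) =
      κ * (u (j + 1) n + u (j - 1) n) + Complex.I * β * u j n) (j n : ℤ) : u j n = 0 := by
  obtain ⟨x, hx⟩ := hu.exists_hasSum_shift_add_shift 0 1
  obtain ⟨y, hy⟩ := hu.exists_hasSum_shift_add_shift 1 0
  simp only [add_zero, sub_zero] at hx hy
  obtain ⟨N, hN⟩ := id hu
  have hN' : HasSum (fun p : ℤ × ℤ => starRingEnd ℂ (u p.1 p.2) * u p.1 p.2) (N : ℂ) := by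
    refine (Complex.hasSum_ofReal.2 hN).of_eq fun p => ?_
    rw [Complex.conj_mul']
    push_cast
    rfl
  -- Pairing the equation with `u` gives x = κy + iβN with x, y, N real; the imaginary part forces N
  -- = ‖u‖² = 0.
  have e := hx.unique (((hy.mul_left (κ : ℂ)).add (hN'.mul_left (Complex.I * β))).of_eq
    fun p => by rw [h]; ring)
  have e2 := congrArg Complex.im e
  simp [hβ] at e2
  subst e2
  have := (hasSum_zero_iff_of_nonneg (fun p => sq_nonneg _)).1 hN
  simpa using congrFun this (j, n)

end SqSummable

/-- The difference of two solutions has no source. By `hκ` the one-step matrix has determinant 1, so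
Cayley–Hamilton decouples the components into wave equations with eigenvalue 2iκμδ. -/
theorem IsLatticeField.eq_of_sqSummable {κ μ δ : ℝ} {a b : (ℤ → ℤ → ℂ) × (ℤ → ℤ → ℂ)}
    (hκ : κ ^ 2 * ((1 + μ ^ 2) * (1 - δ ^ 2)) = 1) (hβ : κ * μ * δ ≠ 0)
    (ha : IsLatticeField κ μ δ a) (hb : IsLatticeField κ μ δ b)
    (ha₁ : SqSummable a.1) (ha₂ : SqSummable a.2) (hb₁ : SqSummable b.1) (hb₂ : SqSummable b.2) :
    a = b := by
  have hκ' : (κ : ℂ) ^ 2 * ((1 + μ ^ 2) * (1 - δ ^ 2)) = 1 := by exact_mod_cast hκ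
  have hI : Complex.I ^ 2 = -1 := Complex.I_sq
  obtain ⟨u, hu⟩ : ∃ u : ℤ → ℤ → ℂ, ∀ j n, u j n = a.1 j n - b.1 j n := ⟨_, fun _ _ => rfl⟩
  obtain ⟨v, hv⟩ : ∃ v : ℤ → ℤ → ℂ, ∀ j n, v j n = a.2 j n - b.2 j n := ⟨_, fun _ _ => rfl⟩
  have e1 : ∀ j n : ℤ, u j n = κ * (u (j + 1) (n - 1) - Complex.I * δ * v (j + 1) (n - 1) +
      μ * (v j (n - 1) + Complex.I * δ * u j (n - 1))) := by
    intro j n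
    simp only [hu, hv]
    linear_combination ha.fst j n - hb.fst j n
  have e2 : ∀ j n : ℤ, v j n = κ * (v (j - 1) (n - 1) + Complex.I * δ * u (j - 1) (n - 1) -
      μ * (u j (n - 1) - Complex.I * δ * v j (n - 1))) := by
    intro j n
    simp only [hu, hv]
    linear_combination ha.snd j n - hb.snd j n
  have hus : SqSummable u := by
    have : u = fun j n => a.1 j n - b.1 j n := funext fun j => funext fun n => hu j n
    rw [this]
    exact ha₁.sub hb₁
  have hvs : SqSummable v := by
    have : v = fun j n => a.2 j n - b.2 j n := funext fun j => funext fun n => hv j n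
    rw [this]
    exact ha₂.sub hb₂
  have hβ' : 2 * (κ * μ * δ) ≠ 0 := mul_ne_zero two_ne_zero hβ
  have hu0 := hus.eq_zero_of_wave (κ := κ) hβ' fun j n => by
    have f1 := e1 j (n + 1)
    have f2 := e1 (j - 1) n
    have f3 := e1 j n
    have f4 := e2 j n
    have f5 := e2 (j + 1) n
    simp only [add_sub_cancel_right, sub_add_cancel] at f1 f2 f3 f4 f5
    push_cast
    linear_combination f1 - κ * (f2 + Complex.I * μ * δ * f3) +
      κ * (μ * f4 - Complex.I * δ * f5) - u j (n - 1) * hκ' -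
      u j (n - 1) * κ ^ 2 * δ ^ 2 * (1 + μ ^ 2) * hI
  have hv0 := hvs.eq_zero_of_wave (κ := κ) hβ' fun j n => by
    have f1 := e2 j (n + 1)
    have f2 := e2 (j + 1) n
    have f3 := e2 j n
    have f4 := e1 j n
    have f5 := e1 (j - 1) n
    simp only [add_sub_cancel_right, sub_add_cancel] at f1 f2 f3 f4 f5
    push_cast
    linear_combination f1 - κ * (f2 + Complex.I * μ * δ * f3) +
      κ * (Complex.I * δ * f5 - μ * f4) - v j (n - 1) * hκ' -
      v j (n - 1) * κ ^ 2 * δ ^ 2 * (1 + μ ^ 2) * hI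
  refine Prod.ext (funext fun j => funext fun n => ?_) (funext fun j => funext fun n => ?_)
  · exact sub_eq_zero.1 ((hu j n).symm.trans (hu0 j n))
  · exact sub_eq_zero.1 ((hv j n).symm.trans (hv0 j n))

/-! ### The Green function by Fourier transform in space -/

section

open MeasureTheory

section Dispersion

/-- For `T` in the upper half plane, the square root of `1 - T ^ 2` with positive real part. -/
noncomputable def dispersionRoot (T : ℂ) : ℂ := (1 - T ^ 2) ^ (1 / 2 : ℂ)

/-- For `T` in the upper half plane, the root of `λ ^ 2 - 2 T λ + 1` inside the unit disc. -/
noncomputable def dispersionEigenvalue (T : ℂ) : ℂ := T - Complex.I * dispersionRoot T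

variable {T : ℂ}

theorem dispersionRoot_sq (T : ℂ) : dispersionRoot T ^ 2 = 1 - T ^ 2 := by
  rw [dispersionRoot, ← Complex.cpow_nat_mul]
  simp

theorem dispersionEigenvalue_sq_add_one (T : ℂ) :
    dispersionEigenvalue T ^ 2 + 1 = 2 * T * dispersionEigenvalue T := by
  have h := dispersionRoot_sq T
  rw [dispersionEigenvalue]
  linear_combination -h + dispersionRoot T ^ 2 * Complex.I_sq

theorem one_sub_sq_mem_slitPlane (hT : 0 < T.im) : 1 - T ^ 2 ∈ Complex.slitPlane := by
  rw [Complex.mem_slitPlane_iff]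
  by_contra! h
  obtain ⟨h1, h2⟩ := h
  simp [pow_two] at h1 h2
  have h3 : T.re = 0 := by
    have : T.re * T.im = 0 := by linarith
    exact (mul_eq_zero.1 this).resolve_right hT.ne'
  rw [h3] at h1
  nlinarith

theorem dispersionRoot_re_pos (h : 1 - T ^ 2 ∈ Complex.slitPlane) : 0 < (dispersionRoot T).re := by
  have h0 := Complex.slitPlane_ne_zero h
  rw [dispersionRoot, Complex.cpow_def_of_ne_zero h0, Complex.exp_re]
  refine mul_pos (Real.exp_pos _) (Real.cos_pos_of_mem_Ioo ?_)
  have h1 := Complex.neg_pi_lt_arg (1 - T ^ 2)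
  have h2 := (Complex.arg_le_pi (1 - T ^ 2)).lt_of_ne (Complex.mem_slitPlane_iff_arg.1 h).1
  have e : (Complex.log (1 - T ^ 2) * (1 / 2)).im = Complex.arg (1 - T ^ 2) / 2 := by
    rw [mul_comm, show (1 / 2 : ℂ) = ((1 / 2 : ℝ) : ℂ) by push_cast; rfl, Complex.im_ofReal_mul,
      Complex.log_im]
    ring
  rw [e]
  constructor <;> linarith

theorem dispersionRoot_ne_zero (h : 1 - T ^ 2 ∈ Complex.slitPlane) : dispersionRoot T ≠ 0 := by
  intro h0
  have := dispersionRoot_re_pos h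
  simp [h0] at this

/-- The other root u = T + i√(1-T²) is the inverse and has Im u > 0. From u + u⁻¹ = 2T one gets Im u
· (1 - 1/|u|²) = 2 Im T > 0, so |u| > 1. -/
theorem norm_dispersionEigenvalue_lt_one (hT : 0 < T.im) : ‖dispersionEigenvalue T‖ < 1 := by
  obtain ⟨u, hu⟩ : ∃ u, u = T + Complex.I * dispersionRoot T := ⟨_, rfl⟩
  have h1 : dispersionEigenvalue T * u = 1 := by
    rw [dispersionEigenvalue, hu]
    linear_combination dispersionRoot_sq T - dispersionRoot T ^ 2 * Complex.I_sq
  have h2 : 0 < u.im := by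
    have := dispersionRoot_re_pos (one_sub_sq_mem_slitPlane hT)
    simp [hu]
    linarith
  have h3 : dispersionEigenvalue T = u⁻¹ := eq_inv_of_mul_eq_one_left h1
  have h4 : (u⁻¹).im + u.im = 2 * T.im := by
    rw [← h3, dispersionEigenvalue, hu]
    simp
    ring
  rw [Complex.inv_im] at h4
  have hN : 0 < Complex.normSq u := Complex.normSq_pos.2 fun h => by simp [h] at h2
  have h5 : 1 < Complex.normSq u := by
    by_contra! h
    have : u.im ≤ u.im / Complex.normSq u := by
      rw [le_div_iff₀ hN]
      nlinarith
    rw [neg_div] at h4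
    linarith
  rw [h3, norm_inv]
  refine inv_lt_one_of_one_lt₀ ?_
  rw [Complex.normSq_eq_norm_sq] at h5
  exact (one_lt_sq_iff₀ (norm_nonneg _)).1 h5

theorem continuousAt_dispersionRoot (h : 1 - T ^ 2 ∈ Complex.slitPlane) :
    ContinuousAt dispersionRoot T := by
  refine ContinuousAt.cpow (by fun_prop) continuousAt_const h

theorem continuousAt_dispersionEigenvalue (h : 1 - T ^ 2 ∈ Complex.slitPlane) :
    ContinuousAt dispersionEigenvalue T :=
  continuousAt_id.sub (continuousAt_const.mul (continuousAt_dispersionRoot h))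

end Dispersion

section Symbol

/-- The cosine on the unit circle. -/
noncomputable def circleCos (p : UnitAddCircle) : ℝ := (fourier (T := 1) 1 p).re

theorem continuous_circleCos : Continuous circleCos := by
  unfold circleCos
  fun_prop

theorem two_mul_circleCos (p : UnitAddCircle) :
    2 * (circleCos p : ℂ) = fourier (T := 1) 1 p + fourier (T := 1) (-1) p := by
  rw [fourier_neg, Complex.add_conj, circleCos]
  push_cast
  rfl

theorem abs_circleCos_le_one (p : UnitAddCircle) : |circleCos p| ≤ 1 := by
  refine (Complex.abs_re_le_norm _).trans (((fourier (T := 1) 1).norm_coe_le_norm p).trans ?_)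
  rw [fourier_norm]

/-- The symbol of the spatial part of the lattice wave operator. -/
noncomputable def waveSymbol (κ y : ℝ) (p : UnitAddCircle) : ℂ := κ * circleCos p + Complex.I * y

theorem waveSymbol_im (κ y : ℝ) (p : UnitAddCircle) : (waveSymbol κ y p).im = y := by
  simp [waveSymbol]

theorem continuous_waveSymbol (κ y : ℝ) : Continuous (waveSymbol κ y) := by
  have := continuous_circleCos
  unfold waveSymbol
  fun_prop

variable {κ y : ℝ}

/-- The spatial Fourier transform of the Green function at time `n`. -/
noncomputable def greenSymbol (κ y : ℝ) (n : ℤ) (p : UnitAddCircle) : ℂ :=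
  dispersionEigenvalue (waveSymbol κ y p) ^ n.natAbs /
    (-2 * Complex.I * dispersionRoot (waveSymbol κ y p))

theorem waveSymbol_mem (hy : 0 < y) (p : UnitAddCircle) :
    1 - waveSymbol κ y p ^ 2 ∈ Complex.slitPlane :=
  one_sub_sq_mem_slitPlane (by rwa [waveSymbol_im])

theorem neg_two_mul_I_mul_ne_zero {s : ℂ} (hs : s ≠ 0) : -2 * Complex.I * s ≠ 0 :=
  mul_ne_zero (mul_ne_zero (by norm_num) Complex.I_ne_zero) hs

theorem continuous_dispersionEigenvalue_waveSymbol (hy : 0 < y) :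
    Continuous fun p => dispersionEigenvalue (waveSymbol κ y p) :=
  continuous_iff_continuousAt.2 fun p =>
    (continuousAt_dispersionEigenvalue (waveSymbol_mem hy p)).comp
      (f := waveSymbol κ y) (continuous_waveSymbol κ y).continuousAt

theorem continuous_dispersionRoot_waveSymbol (hy : 0 < y) :
    Continuous fun p => dispersionRoot (waveSymbol κ y p) :=
  continuous_iff_continuousAt.2 fun p =>
    (continuousAt_dispersionRoot (waveSymbol_mem hy p)).comp
      (f := waveSymbol κ y) (continuous_waveSymbol κ y).continuousAt

theorem continuous_greenSymbol (hy : 0 < y) (n : ℤ) : Continuous (greenSymbol κ y n) :=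
  ((continuous_dispersionEigenvalue_waveSymbol hy).pow _).div
    (continuous_const.mul (continuous_dispersionRoot_waveSymbol hy)) fun p =>
      neg_two_mul_I_mul_ne_zero (dispersionRoot_ne_zero (waveSymbol_mem hy p))

theorem greenSymbol_wave (hy : 0 < y) (n : ℤ) (p : UnitAddCircle) :
    greenSymbol κ y (n + 1) p + greenSymbol κ y (n - 1) p =
      2 * waveSymbol κ y p * greenSymbol κ y n p + if n = 0 then 1 else 0 := by
  have hs := dispersionRoot_ne_zero (waveSymbol_mem (κ := κ) hy p)
  have hl := dispersionEigenvalue_sq_add_one (waveSymbol κ y p)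
  simp only [greenSymbol]
  rcases lt_trichotomy n 0 with h | rfl | h
  · obtain ⟨k, rfl⟩ : ∃ k : ℕ, n = -(k + 1) := ⟨(-n - 1).toNat, by omega⟩
    rw [show (-((k : ℤ) + 1) + 1).natAbs = k by omega,
      show (-((k : ℤ) + 1) - 1).natAbs = k + 2 by omega,
      show (-((k : ℤ) + 1)).natAbs = k + 1 by omega, if_neg (by omega)]
    linear_combination dispersionEigenvalue (waveSymbol κ y p) ^ k /
      (-2 * Complex.I * dispersionRoot (waveSymbol κ y p)) * hl
  -- At the kink n = 0 both neighbours contribute λ, and 2λ - 2T = -2i√(1-T²) is the normalising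
  -- denominator; hence the unit source.
  · have hd : dispersionEigenvalue (waveSymbol κ y p) = waveSymbol κ y p -
      Complex.I * dispersionRoot (waveSymbol κ y p) := rfl
    simp only [zero_add, Int.natAbs_one, pow_one, zero_sub, Int.natAbs_neg, Int.natAbs_zero,
      pow_zero, if_true]
    rw [← add_div, div_eq_iff (neg_two_mul_I_mul_ne_zero hs), hd, add_mul, mul_assoc,
      div_mul_cancel₀ _ (neg_two_mul_I_mul_ne_zero hs)]
    ring
  · obtain ⟨k, rfl⟩ : ∃ k : ℕ, n = k + 1 := ⟨(n - 1).toNat, by omega⟩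
    rw [show ((k : ℤ) + 1 + 1).natAbs = k + 2 by omega,
      show ((k : ℤ) + 1 - 1).natAbs = k by omega,
      show ((k : ℤ) + 1).natAbs = k + 1 by omega, if_neg (by omega)]
    linear_combination dispersionEigenvalue (waveSymbol κ y p) ^ k /
      (-2 * Complex.I * dispersionRoot (waveSymbol κ y p)) * hl

/-- The Green function of the lattice wave operator. -/
noncomputable def latticeGreen (κ y : ℝ) (j n : ℤ) : ℂ := fourierCoeff (greenSymbol κ y n) j

theorem integrable_fourier_smul {f : UnitAddCircle → ℂ} (hf : Continuous f) (j : ℤ) :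
    Integrable (fun p => fourier j p • f p) AddCircle.haarAddCircle :=
  (Continuous.smul (f := fun p => fourier j p) (fourier j).continuous
    hf).integrable_of_hasCompactSupport
    (HasCompactSupport.of_compactSpace _)

theorem fourierCoeff_add_of_continuous {f g : UnitAddCircle → ℂ} (hf : Continuous f)
    (hg : Continuous g) (j : ℤ) :
    fourierCoeff f j + fourierCoeff g j = fourierCoeff (fun p => f p + g p) j := by
  unfold fourierCoeff
  rw [← integral_add (integrable_fourier_smul hf _) (integrable_fourier_smul hg _)]
  simp only [smul_add]

/-- A shift of the coefficients is multiplication by a character, and the two opposite characters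
add up to twice the cosine. -/
theorem fourierCoeff_shift_add_shift (f : UnitAddCircle → ℂ) (hf : Continuous f) (j : ℤ) :
    fourierCoeff f (j + 1) + fourierCoeff f (j - 1) =
      fourierCoeff (fun p => 2 * (circleCos p : ℂ) * f p) j := by
  trans fourierCoeff (fun p => fourier (T := 1) (-1) p * f p) j +
    fourierCoeff (fun p => fourier (T := 1) 1 p * f p) j
  · unfold fourierCoeff
    congr 2 <;> funext p <;> simp only [smul_eq_mul]
    · rw [show -(j + 1) = -j + -1 by ring, fourier_add]
      ring
    · rw [show -(j - 1) = -j + 1 by ring, fourier_add]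
      ring
  · rw [fourierCoeff_add_of_continuous (by fun_prop) (by fun_prop)]
    congr 1
    funext p
    rw [two_mul_circleCos]
    ring

theorem latticeGreen_wave (hy : 0 < y) (j n : ℤ) :
    latticeGreen κ y j (n + 1) + latticeGreen κ y j (n - 1) =
      κ * (latticeGreen κ y (j + 1) n + latticeGreen κ y (j - 1) n) +
        2 * Complex.I * y * latticeGreen κ y j n + if j = 0 ∧ n = 0 then 1 else 0 := by
  have hc := continuous_greenSymbol (κ := κ) hy
  have hcos := continuous_circleCos
  have h1 : (fourierCoeff (fun _ : UnitAddCircle => (if n = 0 then 1 else 0 : ℂ)) j) =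
      if j = 0 ∧ n = 0 then 1 else 0 := by
    by_cases hn : n = 0
    · have := congrFun (fourierCoeff_fourier (T := 1) 0) j
      have e : (fun _ : UnitAddCircle => (1 : ℂ)) = fourier (T := 1) 0 := by
        funext p; simp
      simp [hn, e, this, Pi.single_apply]
    · simp [hn, fourierCoeff]
  rw [← h1]
  simp only [latticeGreen]
  rw [fourierCoeff_shift_add_shift _ (hc n), ← fourierCoeff.const_mul, ← fourierCoeff.const_mul,
    fourierCoeff_add_of_continuous (hc _) (hc _),
    fourierCoeff_add_of_continuous (by fun_prop) (by fun_prop),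
    fourierCoeff_add_of_continuous (by fun_prop) (by fun_prop)]
  congr 1
  funext p
  rw [greenSymbol_wave hy n p, waveSymbol]
  ring

theorem latticeGreen_neg (j n : ℤ) : latticeGreen κ y j (-n) = latticeGreen κ y j n := by
  have : greenSymbol κ y (-n) = greenSymbol κ y n := by simp [greenSymbol, funext_iff]
  rw [latticeGreen, this, latticeGreen]

theorem hasSum_sq_fourierCoeff_of_continuous (f : C(UnitAddCircle, ℂ)) :
    HasSum (fun i => ‖fourierCoeff f i‖ ^ 2) (∫ t, ‖f t‖ ^ 2 ∂AddCircle.haarAddCircle) := by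
  have h := hasSum_sq_fourierCoeff (ContinuousMap.toLp 2 AddCircle.haarAddCircle ℂ f)
  simp only [fourierCoeff_toLp] at h
  convert h using 1
  refine integral_congr_ae ?_
  filter_upwards [ContinuousMap.coeFn_toLp (p := 2) (𝕜 := ℂ) AddCircle.haarAddCircle f] with t ht
  rw [ht]

/-- By compactness of the circle |λ| ≤ r < 1 uniformly. Parseval in space bounds row n by a multiple
of r^(2|n|), which is summable in n. -/
theorem sqSummable_latticeGreen (hy : 0 < y) : SqSummable (latticeGreen κ y) := by
  obtain ⟨p₀, -, hp₀⟩ := isCompact_univ.exists_isMaxOn (Set.univ_nonempty)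
    (continuous_dispersionEigenvalue_waveSymbol (κ := κ) hy).norm.continuousOn
  obtain ⟨p₁, -, hp₁⟩ := isCompact_univ.exists_isMaxOn (Set.univ_nonempty)
    (continuous_greenSymbol (κ := κ) hy 0).norm.continuousOn
  obtain ⟨r, hr⟩ : ∃ r, r = ‖dispersionEigenvalue (waveSymbol κ y p₀)‖ := ⟨_, rfl⟩
  obtain ⟨C, hC⟩ : ∃ C, C = ‖greenSymbol κ y 0 p₁‖ := ⟨_, rfl⟩
  have hr0 : 0 ≤ r := hr ▸ norm_nonneg _
  have hr1 : r < 1 := hr ▸ norm_dispersionEigenvalue_lt_one (by rwa [waveSymbol_im])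
  have hb : ∀ n p, ‖greenSymbol κ y n p‖ ≤ r ^ n.natAbs * C := by
    intro n p
    have h1 := hp₀ (Set.mem_univ p)
    have h2 := hp₁ (Set.mem_univ p)
    simp only [Set.mem_ofPred_eq, ← hr, ← hC] at h1 h2
    have : greenSymbol κ y n p = dispersionEigenvalue (waveSymbol κ y p) ^ n.natAbs *
        greenSymbol κ y 0 p := by
      simp [greenSymbol, div_eq_mul_inv]
    rw [this, norm_mul, norm_pow]
    gcongr
  have hn : ∀ n : ℤ, HasSum (fun j => ‖latticeGreen κ y j n‖ ^ 2)
      (∫ t, ‖greenSymbol κ y n t‖ ^ 2 ∂AddCircle.haarAddCircle) := fun n =>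
    hasSum_sq_fourierCoeff_of_continuous ⟨_, continuous_greenSymbol hy n⟩
  refine (Equiv.prodComm ℤ ℤ).summable_iff.1 ((summable_prod_of_nonneg
    fun _ => sq_nonneg _).2 ⟨fun n => (hn n).summable, ?_⟩)
  have hg : Summable fun n : ℤ => (r ^ n.natAbs * C) ^ 2 := by
    have : Summable fun n : ℕ => (r ^ n * C) ^ 2 := by
      have := (summable_geometric_of_lt_one (r := r ^ 2) (sq_nonneg r)
        (by nlinarith)).mul_right (C ^ 2)
      refine this.congr fun n => ?_
      ring
    refine Summable.of_nat_of_neg ?_ ?_ <;> simpa using this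
  refine Summable.of_nonneg_of_le (fun n => tsum_nonneg fun _ => sq_nonneg _) (fun n => ?_) hg
  refine ((hn n).tsum_eq).trans_le ?_
  calc _ ≤ ∫ _ : UnitAddCircle, (r ^ n.natAbs * C) ^ 2 ∂AddCircle.haarAddCircle := by
        refine integral_mono ?_ (integrable_const _) fun p => ?_
        · exact ((continuous_greenSymbol hy n).norm.pow 2).integrable_of_hasCompactSupport
            (HasCompactSupport.of_compactSpace _)
        · have := hb n p
          dsimp only
          gcongr
    _ = _ := by simp

end Symbol

end

/-! ### The field of a point source and its limit as δ ↘ 0 -/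

section

open MeasureTheory

section Field

/-- The field generated by a point source, in terms of the Green function. -/
noncomputable def greenField (κ μ δ : ℝ) : (ℤ → ℤ → ℂ) × (ℤ → ℤ → ℂ) :=
  (fun j n => 2 * κ * (μ * latticeGreen κ (κ * μ * δ) j n -
      Complex.I * δ * latticeGreen κ (κ * μ * δ) (j + 1) n),
    fun j n => 2 * (latticeGreen κ (κ * μ * δ) j (n + 1) -
      κ * latticeGreen κ (κ * μ * δ) (j + 1) n -
      Complex.I * κ * μ * δ * latticeGreen κ (κ * μ * δ) j n))

variable {κ μ δ : ℝ}

/-- With M the one-step matrix and S the delay by one time unit, det(1 - SM) is S times the wave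
operator. The field is the second column of the adjugate of 1 - SM, applied to twice the Green
function advanced by one step. The first equation is then a formal identity; the second is the wave
equation. -/
theorem isLatticeField_greenField (hκ : κ ^ 2 * ((1 + μ ^ 2) * (1 - δ ^ 2)) = 1)
    (hy : 0 < κ * μ * δ) : IsLatticeField κ μ δ (greenField κ μ δ) := by
  have hκ' : (κ : ℂ) ^ 2 * ((1 + μ ^ 2) * (1 - δ ^ 2)) = 1 := by exact_mod_cast hκ
  have hI : Complex.I ^ 2 = -1 := Complex.I_sq
  obtain ⟨G, hG⟩ : ∃ G, G = latticeGreen κ (κ * μ * δ) := ⟨_, rfl⟩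
  constructor
  · intro j n
    simp only [greenField, ← hG, sub_add_cancel]
    ring
  · intro j n
    have h := latticeGreen_wave (κ := κ) hy j n
    simp only [greenField, ← hG, sub_add_cancel] at h ⊢
    have e : (2 * (if j = 0 then 1 else 0) * (if n = 0 then 1 else 0) : ℂ) =
        2 * (if j = 0 ∧ n = 0 then 1 else 0) := by
      by_cases h1 : j = 0 <;> by_cases h2 : n = 0 <;> simp [h1, h2]
    rw [e]
    push_cast at h
    linear_combination 2 * h + 2 * G j (n - 1) * hκ' +
      2 * G j (n - 1) * κ ^ 2 * δ ^ 2 * (1 + μ ^ 2) * hI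

theorem sqSummable_greenField (hy : 0 < κ * μ * δ) :
    SqSummable (greenField κ μ δ).1 ∧ SqSummable (greenField κ μ δ).2 := by
  have h := sqSummable_latticeGreen (κ := κ) hy
  have h1 := h.shift 1 0
  have h2 := h.shift 0 1
  simp only [add_zero] at h1 h2
  constructor
  · exact ((h.const_mul _).sub (h1.const_mul _)).const_mul _
  · exact ((h2.sub (h1.const_mul _)).sub (h.const_mul _)).const_mul _

/-- Evenness of the Green function in time and the wave equation at time 0 eliminate its value at
time 1, leaving only row 0. -/
theorem greenField_snd_zero (hy : 0 < κ * μ * δ) (j : ℤ) :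
    (greenField κ μ δ).2 j 0 = (if j = 0 then 1 else 0) + κ *
      (latticeGreen κ (κ * μ * δ) (j - 1) 0 - latticeGreen κ (κ * μ * δ) (j + 1) 0) := by
  have h := latticeGreen_wave (κ := κ) hy j 0
  rw [zero_sub, latticeGreen_neg, zero_add] at h
  simp only [greenField, and_true, zero_add] at h ⊢
  push_cast at h
  linear_combination h

end Field

section Limit

theorem one_sub_sq_mem_slitPlane_of_real {κ : ℝ} (hκ : κ ^ 2 < 1) (p : UnitAddCircle) :
    1 - waveSymbol κ 0 p ^ 2 ∈ Complex.slitPlane := by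
  refine Or.inl ?_
  have h := (sq_le_one_iff_abs_le_one _).2 (abs_circleCos_le_one p)
  have e : 1 - waveSymbol κ 0 p ^ 2 = ((1 - κ ^ 2 * circleCos p ^ 2 : ℝ) : ℂ) := by
    rw [waveSymbol]; push_cast; ring
  rw [e, Complex.ofReal_re]
  nlinarith [sq_nonneg κ]

/-- The real part of 1 - T² is 1 - κ²cos² + y² ≥ q. This bound does not degenerate as `y → 0` and
serves as the dominating constant. -/
theorem norm_greenSymbol_le {κ y q : ℝ} (hy : 0 < y) (hq : 0 < q) (hκ : κ ^ 2 ≤ 1 - q) (n : ℤ)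
    (p : UnitAddCircle) : ‖greenSymbol κ y n p‖ ≤ 1 / √q := by
  have h := (sq_le_one_iff_abs_le_one _).2 (abs_circleCos_le_one p)
  have h1 : q ≤ ‖dispersionRoot (waveSymbol κ y p)‖ ^ 2 := by
    rw [← norm_pow, dispersionRoot_sq]
    refine le_trans ?_ (Complex.re_le_norm _)
    simp [waveSymbol, pow_two] at h ⊢
    nlinarith [sq_nonneg κ]
  have h2 : √q ≤ ‖dispersionRoot (waveSymbol κ y p)‖ := Real.sqrt_le_iff.2 ⟨norm_nonneg _, h1⟩
  have h3 : ‖dispersionEigenvalue (waveSymbol κ y p)‖ < 1 :=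
    norm_dispersionEigenvalue_lt_one (by rwa [waveSymbol_im])
  have hq' := Real.sqrt_pos.2 hq
  rw [greenSymbol, norm_div, norm_pow, norm_mul]
  refine div_le_div₀ zero_le_one (pow_le_one₀ (norm_nonneg _) h3.le) hq' ?_
  simp
  linarith

theorem tendsto_latticeGreen {ι : Type*} {l : Filter ι} [l.IsCountablyGenerated] {κ y : ι → ℝ}
    {κ₀ : ℝ} (hκ : Tendsto κ l (𝓝 κ₀)) (hκ₀ : κ₀ ^ 2 < 1) (hy : Tendsto y l (𝓝 0))
    (hy' : ∀ᶠ i in l, 0 < y i) (j n : ℤ) :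
    Tendsto (fun i => latticeGreen (κ i) (y i) j n) l (𝓝 (latticeGreen κ₀ 0 j n)) := by
  -- Half of the gap 1 - κ₀² survives for κ near κ₀.
  obtain ⟨q, hq0, hq⟩ : ∃ q, 0 < q ∧ κ₀ ^ 2 < 1 - q :=
    ⟨(1 - κ₀ ^ 2) / 2, by linarith, by linarith⟩
  have hb := (hκ.pow 2).eventually (gt_mem_nhds hq)
  refine tendsto_integral_filter_of_dominated_convergence (fun _ => 1 / √q) ?_ ?_
    (integrable_const _) (Eventually.of_forall fun p => ?_)
  · filter_upwards [hy'] with i hi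
    exact (integrable_fourier_smul (continuous_greenSymbol hi n) _).aestronglyMeasurable
  · filter_upwards [hy', hb] with i hi hbi
    refine Eventually.of_forall fun p => ?_
    rw [norm_smul]
    have h1 : ‖fourier (T := 1) (-j) p‖ ≤ 1 :=
      ((fourier (T := 1) (-j)).norm_coe_le_norm p).trans_eq (fourier_norm _)
    calc _ ≤ 1 * (1 / √q) := by
          gcongr
          exact norm_greenSymbol_le hi hq0 hbi.le n p
      _ = _ := one_mul _
  · have hm := one_sub_sq_mem_slitPlane_of_real hκ₀ p
    have hT : Tendsto (fun i => waveSymbol (κ i) (y i) p) l (𝓝 (waveSymbol κ₀ 0 p)) := by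
      have h1 := (Complex.continuous_ofReal.tendsto _).comp hκ
      have h2 := (Complex.continuous_ofReal.tendsto _).comp hy
      exact (h1.mul_const _).add (h2.const_mul _)
    refine Tendsto.const_smul (Tendsto.div ?_ ?_ ?_) _
    · exact ((continuousAt_dispersionEigenvalue hm).tendsto.comp hT).pow _
    · exact ((continuousAt_dispersionRoot hm).tendsto.comp hT).const_mul _
    · exact neg_two_mul_I_mul_ne_zero (dispersionRoot_ne_zero hm)

variable {μ : ℝ}

/-- The normalisation factor of a full step of the lattice evolution. -/
noncomputable def latticeCoupling (μ δ : ℝ) : ℝ := 1 / √(1 + μ ^ 2) * (1 / √(1 - δ ^ 2))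

theorem latticeCoupling_sq_mul {δ : ℝ} (hδ : δ ^ 2 < 1) :
    latticeCoupling μ δ ^ 2 * ((1 + μ ^ 2) * (1 - δ ^ 2)) = 1 := by
  have h1 : 0 < 1 + μ ^ 2 := by positivity
  have h2 : 0 < 1 - δ ^ 2 := by linarith
  rw [latticeCoupling, mul_pow, div_pow, div_pow, Real.sq_sqrt h1.le, Real.sq_sqrt h2.le]
  field_simp

theorem latticeCoupling_pos {δ : ℝ} (hδ : δ ^ 2 < 1) : 0 < latticeCoupling μ δ := by
  have h1 : 0 < 1 + μ ^ 2 := by positivity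
  have h2 : 0 < 1 - δ ^ 2 := by linarith
  unfold latticeCoupling
  positivity

theorem tendsto_latticeCoupling :
    Tendsto (latticeCoupling μ) (𝓝[>] 0) (𝓝 (latticeCoupling μ 0)) := by
  have : ContinuousAt (latticeCoupling μ) 0 := by
    unfold latticeCoupling
    refine continuousAt_const.mul (continuousAt_const.div (by fun_prop) ?_)
    simp
  exact this.tendsto.mono_left nhdsWithin_le_nhds

theorem latticeCoupling_zero_sq_lt_one (hμ : 0 < μ) : latticeCoupling μ 0 ^ 2 < 1 := by
  have h := latticeCoupling_sq_mul (μ := μ) (δ := 0) (by norm_num)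
  have h1 := latticeCoupling_pos (μ := μ) (δ := 0) (by norm_num)
  have h2 : 0 < latticeCoupling μ 0 ^ 2 * μ ^ 2 := by positivity
  nlinarith

theorem eventually_pos_sq_lt_one : ∀ᶠ δ : ℝ in 𝓝[>] 0, 0 < δ ∧ δ ^ 2 < 1 := by
  filter_upwards [Ioo_mem_nhdsGT (zero_lt_one' ℝ)] with δ hδ
  exact ⟨hδ.1, by nlinarith [hδ.1, hδ.2]⟩

theorem eventually_latticeCoupling_mul_pos (hμ : 0 < μ) :
    ∀ᶠ δ : ℝ in 𝓝[>] 0, 0 < latticeCoupling μ δ * μ * δ := by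
  filter_upwards [eventually_pos_sq_lt_one] with δ h
  exact mul_pos (mul_pos (latticeCoupling_pos h.2) hμ) h.1

theorem tendsto_latticeGreen_latticeCoupling (hμ : 0 < μ) (j n : ℤ) :
    Tendsto (fun δ => latticeGreen (latticeCoupling μ δ) (latticeCoupling μ δ * μ * δ) j n)
      (𝓝[>] 0) (𝓝 (latticeGreen (latticeCoupling μ 0) 0 j n)) := by
  have hκ := tendsto_latticeCoupling (μ := μ)
  refine tendsto_latticeGreen hκ (latticeCoupling_zero_sq_lt_one hμ) ?_
    (eventually_latticeCoupling_mul_pos hμ) j n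
  have hδ : Tendsto (fun δ : ℝ => δ) (𝓝[>] 0) (𝓝 0) := nhdsWithin_le_nhds
  simpa using (hκ.mul_const μ).mul hδ

theorem tendsto_greenField (hμ : 0 < μ) (j n : ℤ) :
    Tendsto (fun δ => (greenField (latticeCoupling μ δ) μ δ).1 j n) (𝓝[>] 0)
      (𝓝 ((greenField (latticeCoupling μ 0) μ 0).1 j n)) ∧
    Tendsto (fun δ => (greenField (latticeCoupling μ δ) μ δ).2 j n) (𝓝[>] 0)
      (𝓝 ((greenField (latticeCoupling μ 0) μ 0).2 j n)) := by
  have hκ := tendsto_latticeCoupling (μ := μ)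
  have hδ : Tendsto (fun δ : ℝ => δ) (𝓝[>] 0) (𝓝 0) := nhdsWithin_le_nhds
  have hG := tendsto_latticeGreen_latticeCoupling hμ
  have hκ' := (Complex.continuous_ofReal.tendsto _).comp hκ
  have hδ' := (Complex.continuous_ofReal.tendsto _).comp hδ
  simp only [greenField, mul_zero]
  constructor
  · exact (hκ'.const_mul 2).mul (((hG j n).const_mul _).sub ((hδ'.const_mul _).mul (hG _ _)))
  · exact (((hG j (n + 1)).sub (hκ'.mul (hG _ _))).sub
      ((((hκ'.const_mul _).mul_const _).mul hδ').mul (hG _ _))).const_mul 2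

/-- At δ = 0 the wave equation was not derived, since it needs a positive imaginary part; the
equations are instead limits of those for δ > 0. -/
theorem isLatticeField_greenField_zero (hμ : 0 < μ) :
    IsLatticeField (latticeCoupling μ 0) μ 0 (greenField (latticeCoupling μ 0) μ 0) := by
  have hκ' := (Complex.continuous_ofReal.tendsto _).comp (tendsto_latticeCoupling (μ := μ))
  have hδ' : Tendsto (fun δ : ℝ => (δ : ℂ)) (𝓝[>] 0) (𝓝 ((0 : ℝ) : ℂ)) :=
    (Complex.continuous_ofReal.tendsto _).comp nhdsWithin_le_nhds
  have h1 := fun j n => (tendsto_greenField hμ j n).1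
  have h2 := fun j n => (tendsto_greenField hμ j n).2
  have hF : ∀ᶠ δ in 𝓝[>] 0,
      IsLatticeField (latticeCoupling μ δ) μ δ (greenField (latticeCoupling μ δ) μ δ) := by
    filter_upwards [eventually_pos_sq_lt_one, eventually_latticeCoupling_mul_pos hμ] with δ h h'
    exact isLatticeField_greenField (latticeCoupling_sq_mul h.2) h'
  constructor
  · intro j n
    refine tendsto_nhds_unique ((h1 j n).congr' (hF.mono fun δ h => h.fst j n)) ?_
    exact hκ'.mul (((h1 _ _).sub ((hδ'.const_mul _).mul (h2 _ _))).add
      (((h2 _ _).add ((hδ'.const_mul _).mul (h1 _ _))).const_mul _))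
  · intro j n
    refine tendsto_nhds_unique ((h2 j n).congr' (hF.mono fun δ h => h.snd j n)) ?_
    exact (hκ'.mul (((h2 _ _).add ((hδ'.const_mul _).mul (h1 _ _))).sub
      (((h1 _ _).sub ((hδ'.const_mul _).mul (h2 _ _))).const_mul _))).add tendsto_const_nhds

theorem greenField_zero_snd_zero (hμ : 0 < μ) (j : ℤ) :
    (greenField (latticeCoupling μ 0) μ 0).2 j 0 = (if j = 0 then 1 else 0) +
      latticeCoupling μ 0 * (latticeGreen (latticeCoupling μ 0) 0 (j - 1) 0 -
        latticeGreen (latticeCoupling μ 0) 0 (j + 1) 0) := by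
  have hκ' := (Complex.continuous_ofReal.tendsto _).comp (tendsto_latticeCoupling (μ := μ))
  have hG := tendsto_latticeGreen_latticeCoupling hμ
  refine tendsto_nhds_unique (((tendsto_greenField hμ j 0).2).congr'
    ((eventually_latticeCoupling_mul_pos hμ).mono fun δ h => greenField_snd_zero h j)) ?_
  exact (hκ'.mul ((hG _ _).sub (hG _ _))).const_add _

end Limit

section Plane

variable {m ε : ℝ}

theorem latticeCoupling_mul (m ε δ : ℝ) :
    latticeCoupling (m * ε) δ = 1 / √(1 + m ^ 2 * ε ^ 2) * (1 / √(1 - δ ^ 2)) := by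
  rw [latticeCoupling, mul_pow]

theorem isAnticheckersField_greenField (hm : 0 < m) (hε : 0 < ε) {δ : ℝ} (hδ : 0 < δ)
    (hδ1 : δ ^ 2 < 1) : IsAnticheckersField m ε δ
      (latticeExtend ε δ (greenField (latticeCoupling (m * ε) δ) (m * ε) δ)) := by
  have hy : 0 < latticeCoupling (m * ε) δ * (m * ε) * δ :=
    mul_pos (mul_pos (latticeCoupling_pos hδ1) (mul_pos hm hε)) hδ
  have h := sqSummable_greenField hy
  refine isAnticheckersField_latticeExtend hε.ne' ?_ (Summable.add h.1 h.2)
  have := isLatticeField_greenField (latticeCoupling_sq_mul hδ1) hy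
  rwa [← latticeCoupling_mul]

theorem IsAnticheckersField.eq_greenField (hm : 0 < m) (hε : 0 < ε) {δ : ℝ} (hδ : 0 < δ)
    (hδ1 : δ ^ 2 < 1) {A : (ℝ → ℝ → ℂ) × (ℝ → ℝ → ℂ)} (hA : IsAnticheckersField m ε δ A) :
    A = latticeExtend ε δ (greenField (latticeCoupling (m * ε) δ) (m * ε) δ) := by
  have hy : 0 < latticeCoupling (m * ε) δ * (m * ε) * δ :=
    mul_pos (mul_pos (latticeCoupling_pos hδ1) (mul_pos hm hε)) hδ
  have hB := isAnticheckersField_greenField hm hε hδ hδ1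
  refine hA.ext_of_latticeRestrict_eq hε.ne' hB ?_
  have sq : ∀ {C : (ℝ → ℝ → ℂ) × (ℝ → ℝ → ℂ)}, IsAnticheckersField m ε δ C →
      SqSummable (latticeRestrict ε C).1 ∧ SqSummable (latticeRestrict ε C).2 := fun hC =>
    ⟨Summable.of_nonneg_of_le (fun _ => sq_nonneg _)
      (fun _ => le_add_of_nonneg_right (sq_nonneg _)) hC.axiom_three,
    Summable.of_nonneg_of_le (fun _ => sq_nonneg _)
      (fun _ => le_add_of_nonneg_left (sq_nonneg _)) hC.axiom_three⟩
  have lA := hA.isLatticeField hε.ne'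
  have lB := hB.isLatticeField hε.ne'
  rw [← latticeCoupling_mul] at lA lB
  exact lA.eq_of_sqSummable (latticeCoupling_sq_mul hδ1) hy.ne' lB (sq hA).1 (sq hA).2
    (sq hB).1 (sq hB).2

theorem existsUnique_isAnticheckersField (hm : 0 < m) (hε : 0 < ε) {δ : ℝ} (hδ : 0 < δ)
    (hδ1 : δ ^ 2 < 1) : ∃! A, IsAnticheckersField m ε δ A :=
  ⟨_, isAnticheckersField_greenField hm hε hδ hδ1, fun _ hA => hA.eq_greenField hm hε hδ hδ1⟩

theorem tendsto_anticheckersField (hm : 0 < m) (hε : 0 < ε) (j n : ℤ) :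
    Tendsto (fun δ => (anticheckersField m ε δ).1 (ε * j) (ε * n)) (𝓝[>] 0)
      (𝓝 ((greenField (latticeCoupling (m * ε) 0) (m * ε) 0).1 j n)) ∧
    Tendsto (fun δ => (anticheckersField m ε δ).2 (ε * j) (ε * n)) (𝓝[>] 0)
      (𝓝 ((greenField (latticeCoupling (m * ε) 0) (m * ε) 0).2 j n)) := by
  have h := tendsto_greenField (mul_pos hm hε) j n
  have e : ∀ᶠ δ in 𝓝[>] (0 : ℝ), anticheckersField m ε δ =
      latticeExtend ε δ (greenField (latticeCoupling (m * ε) δ) (m * ε) δ) := by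
    filter_upwards [eventually_pos_sq_lt_one] with δ hδ
    have hA : IsAnticheckersField m ε δ (anticheckersField m ε δ) :=
      Classical.epsilon_spec ⟨_, isAnticheckersField_greenField hm hε hδ.1 hδ.2⟩
    exact hA.eq_greenField hm hε hδ.1 hδ.2
  constructor
  · refine h.1.congr' ?_
    filter_upwards [e] with δ hδ
    rw [hδ, (latticeExtend_even hε.ne' _ j n).1]
  · refine h.2.congr' ?_
    filter_upwards [e] with δ hδ
    rw [hδ, (latticeExtend_even hε.ne' _ j n).2]

end Plane

end

/-! ### Generalized binomials and the Green function at time zero -/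

section

open MeasureTheory

theorem genBinom_succ (z : ℝ) (n : ℕ) :
    genBinom z (n + 1) = genBinom z n * ((z - n) / (n + 1)) := by
  rw [genBinom, genBinom, Finset.prod_Icc_succ_top (by omega), Nat.factorial_succ]
  push_cast
  field_simp
  ring

theorem genBinom_add_one_succ (z : ℝ) (n : ℕ) :
    genBinom (z + 1) (n + 1) = genBinom z n * ((z + 1) / (n + 1)) := by
  induction n with
  | zero => simp [genBinom]
  | succ n ih =>
    rw [genBinom_succ, ih, genBinom_succ z n]
    push_cast
    field_simp
    ring

theorem genBinom_zero_right (z : ℝ) : genBinom z 0 = 1 := by simp [genBinom]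

theorem genBinom_natCast_eq_zero {k n : ℕ} (h : k < n) : genBinom k n = 0 := by
  rw [genBinom, Finset.prod_eq_zero (i := k + 1) (by simp; omega) (by push_cast; ring), mul_zero]

theorem genBinom_sub_half (K : ℕ) :
    ((genBinom (K - 1 / 2) (2 * K) : ℝ) : ℂ) * ((-1) ^ K * K.factorial * 4 ^ K) =
      (ascPochhammer ℂ K).eval (1 / 2) := by
  induction K with
  | zero => simp [genBinom, ascPochhammer_zero]
  | succ K ih =>
    rw [show 2 * (K + 1) = 2 * K + 1 + 1 by ring, genBinom_succ,
      show ((K + 1 : ℕ) : ℝ) - 1 / 2 = K - 1 / 2 + 1 by push_cast; ring,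
      genBinom_add_one_succ, ascPochhammer_succ_eval, ← ih, Nat.factorial_succ]
    have e1 : ((K : ℝ) - 1 / 2 + 1) / ((2 * K : ℕ) + 1) = 1 / 2 := by
      rw [div_eq_iff (by positivity)]
      push_cast
      ring
    have e2 : ((K : ℝ) - 1 / 2 + 1 - (2 * K + 1 : ℕ)) / ((2 * K + 1 : ℕ) + 1) =
        -(K + 1 / 2) / (2 * (K + 1)) := by
      rw [div_eq_div_iff (by positivity) (by positivity)]
      push_cast
      ring
    have : (K : ℂ) + 1 ≠ 0 := by exact_mod_cast K.succ_ne_zero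
    rw [e1, e2]
    push_cast
    field_simp
    ring

/-- The left side is, up to i/2 and a power of κ, the term of index r = s + K in the expansion of
the Green function at distance 2K. The ratio of consecutive terms in `s` is the hypergeometric one;
`genBinom_sub_half` supplies the case `s = 0`. -/
theorem half_ascPochhammer_mul_choose (K s : ℕ) :
    (ascPochhammer ℂ (s + K)).eval (1 / 2) / (s + K).factorial / 4 ^ (s + K) *
      ((2 * (s + K)).choose (s + K + K) : ℂ) =
    (-1) ^ K * ((genBinom (K - 1 / 2) (2 * K) : ℝ) : ℂ) *
      ordinaryHypergeometricCoefficient (1 / 2 + K : ℂ) (1 / 2 + K) (1 + (2 * K : ℕ)) s := by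
  have hch : ∀ s : ℕ, ((2 * (s + K)).choose (s + K + K) : ℂ) =
      (2 * (s + K)).factorial / ((s + 2 * K).factorial * s.factorial) := by
    intro s
    rw [show 2 * (s + K) = (s + K + K) + s by ring, Nat.cast_add_choose,
      show s + K + K = s + 2 * K by ring]
  have hf : ∀ k : ℕ, (k.factorial : ℂ) ≠ 0 := fun k => by exact_mod_cast k.factorial_ne_zero
  rw [hch]
  induction s with
  | zero =>
    rw [ordinaryHypergeometricCoefficient, ascPochhammer_zero, ← genBinom_sub_half]
    have h1 := hf K
    have h2 := hf (2 * K)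
    simp only [zero_add, Nat.factorial_zero, Polynomial.eval_one]
    field_simp
  | succ s ih =>
    rw [ordinaryHypergeometricCoefficient_succ, ← mul_assoc, ← ih,
      show 2 * (s + 1 + K) = 2 * (s + K) + 1 + 1 by ring, show s + 1 + K = s + K + 1 by ring,
      show s + 1 + 2 * K = s + 2 * K + 1 by ring, ascPochhammer_succ_eval, Nat.factorial_succ,
      Nat.factorial_succ, Nat.factorial_succ, Nat.factorial_succ, Nat.factorial_succ]
    have h1 := hf (s + K)
    have h2 := hf (s + 2 * K)
    have h3 := hf s
    have h4 : (s : ℂ) + K + 1 ≠ 0 := by exact_mod_cast (s + K).succ_ne_zero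
    have h5 : (s : ℂ) + 2 * K + 1 ≠ 0 := by exact_mod_cast (s + 2 * K).succ_ne_zero
    have h6 : (s : ℂ) + 1 ≠ 0 := by exact_mod_cast s.succ_ne_zero
    have h7 : (1 : ℂ) + 2 * K + s ≠ 0 := by
      rwa [show (1 : ℂ) + 2 * K + s = s + 2 * K + 1 by ring]
    push_cast
    field_simp
    ring

section GreenZero

theorem fourierCoeff_circleCos_pow (N : ℕ) (j : ℤ) :
    fourierCoeff (fun p => (circleCos p : ℂ) ^ N) j =
      (∑ i ∈ Finset.range (N + 1), if 2 * (i : ℤ) - N = j then (N.choose i : ℂ) else 0) / 2 ^ N := by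
  have e : (fun p => (circleCos p : ℂ) ^ N) = fun p => (1 / 2 ^ N : ℂ) *
      (∑ i ∈ Finset.range (N + 1), fun p => (N.choose i : ℂ) *
        fourier (T := 1) (2 * (i : ℤ) - N) p : UnitAddCircle → ℂ) p := by
    funext p
    have h : (circleCos p : ℂ) = 1 / 2 * (fourier (T := 1) 1 p + fourier (T := 1) (-1) p) := by
      rw [← two_mul_circleCos]; ring
    rw [h, mul_pow, add_pow, Finset.sum_apply, div_pow, one_pow]
    congr 1
    refine Finset.sum_congr rfl fun i hi => ?_
    have hi' : i ≤ N := by simpa [Nat.lt_succ_iff] using hi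
    have hp : ∀ (k : ℤ) (n : ℕ), fourier (T := 1) k p ^ n = fourier (T := 1) (n * k) p := by
      intro k n
      induction n with
      | zero => simp
      | succ n ih => rw [pow_succ, ih, ← fourier_add]; congr 2; push_cast; ring
    rw [hp, hp, ← fourier_add, mul_comm]
    congr 3
    push_cast [hi']
    ring
  rw [e, fourierCoeff.const_mul, fourierCoeff.sum _ _ fun i _ =>
    (Continuous.integrable_of_hasCompactSupport (by fun_prop)
      (HasCompactSupport.of_compactSpace _)), Finset.sum_apply, one_div, div_eq_inv_mul]
  congr 1
  refine Finset.sum_congr rfl fun i _ => ?_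
  rw [fourierCoeff.const_mul, fourierCoeff_fourier, Pi.single_apply]
  by_cases h : 2 * (i : ℤ) - N = j
  · simp [h]
  · simp [h, Ne.symm h]

theorem fourierCoeff_circleCos_pow_odd (r : ℕ) {j : ℤ} (hj : Odd j) :
    fourierCoeff (fun p => (circleCos p : ℂ) ^ (2 * r)) j = 0 := by
  rw [fourierCoeff_circleCos_pow, Finset.sum_eq_zero, zero_div]
  intro i _
  rw [if_neg]
  rintro rfl
  exact Int.not_even_iff_odd.2 hj ⟨i - r, by push_cast; ring⟩

theorem fourierCoeff_circleCos_pow_even (r : ℕ) (k : ℤ) :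
    fourierCoeff (fun p => (circleCos p : ℂ) ^ (2 * r)) (2 * k) =
      ((2 * r).choose (r + k.natAbs) : ℂ) / 4 ^ r := by
  rw [fourierCoeff_circleCos_pow, pow_mul]
  norm_num only
  congr 1
  by_cases hk : r < k.natAbs
  · rw [Nat.choose_eq_zero_of_lt (by omega), Nat.cast_zero]
    refine Finset.sum_eq_zero fun i hi => if_neg ?_
    rw [Finset.mem_range] at hi
    push_cast
    omega
  · rw [Finset.sum_eq_single (r + k).toNat]
    · rw [if_pos (by push_cast; omega)]
      -- The surviving index is r + k; for negative k the symmetry of binomial coefficients replaces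
      -- it by r + |k|.
      rcases le_total 0 k with h | h
      · rw [show (r + k).toNat = r + k.natAbs by omega]
      · rw [Nat.choose_symm_of_eq_add (a := (r + k).toNat) (b := r + k.natAbs) (by omega)]
    · intro i _ hne
      refine if_neg ?_
      push_cast
      omega
    · intro h
      rw [Finset.mem_range] at h
      omega

/-- At time 0 and y = 0 the symbol is (i/2)(1 - κ²cos²)^(-1/2). Its binomial series converges
uniformly on the circle because κ² < 1, and is integrated termwise. -/
theorem hasSum_latticeGreen_zero {κ : ℝ} (hκ : κ ^ 2 < 1) (j : ℤ) :
    HasSum (fun r : ℕ => Complex.I / 2 * ((ascPochhammer ℂ r).eval (1 / 2) / r.factorial) *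
      κ ^ (2 * r) * fourierCoeff (fun p => (circleCos p : ℂ) ^ (2 * r)) j)
      (latticeGreen κ 0 j 0) := by
  have hn : ∀ p, ‖((κ : ℂ) * circleCos p) ^ 2‖ ≤ κ ^ 2 := by
    intro p
    have h := (sq_le_one_iff_abs_le_one _).2 (abs_circleCos_le_one p)
    rw [norm_pow, norm_mul, Complex.norm_real, Complex.norm_real, mul_pow]
    simp only [Real.norm_eq_abs, sq_abs]
    nlinarith [sq_nonneg κ]
  have hb : Summable fun r : ℕ =>
      ‖(ascPochhammer ℂ r).eval (1 / 2 : ℂ) / r.factorial‖ * (κ ^ 2) ^ r := by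
    have := (hasSum_one_sub_cpow_neg (1 / 2) (z := ((κ ^ 2 : ℝ) : ℂ))
      (by rw [Complex.norm_real, Real.norm_of_nonneg (sq_nonneg _)]; exact hκ)).summable.norm
    refine this.congr fun r => ?_
    rw [norm_mul, norm_pow, Complex.norm_real, Real.norm_of_nonneg (sq_nonneg _)]
  have key := hasSum_integral_of_dominated_convergence (μ := AddCircle.haarAddCircle)
    (F := fun r p => fourier (T := 1) (-j) p • (Complex.I / 2 *
      ((ascPochhammer ℂ r).eval (1 / 2) / r.factorial * (((κ : ℂ) * circleCos p) ^ 2) ^ r)))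
    (f := fun p => fourier (T := 1) (-j) p • greenSymbol κ 0 0 p)
    (fun r _ => ‖(ascPochhammer ℂ r).eval (1 / 2 : ℂ) / r.factorial‖ * (κ ^ 2) ^ r)
    (fun r => ?_) (fun r => Eventually.of_forall fun p => ?_) (Eventually.of_forall fun _ => hb)
    (integrable_const _) (Eventually.of_forall fun p => ?_)
  · refine key.of_eq fun r => ?_
    rw [← fourierCoeff.const_mul, fourierCoeff]
    congr 1
    funext p
    congr 1
    rw [← pow_mul, mul_pow]
    ring
  · have := continuous_circleCos
    exact (integrable_fourier_smul (by fun_prop) _).aestronglyMeasurable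
  · have h1 : ‖fourier (T := 1) (-j) p‖ ≤ 1 :=
      ((fourier (T := 1) (-j)).norm_coe_le_norm p).trans_eq (fourier_norm _)
    have h2 : ‖Complex.I / 2‖ ≤ 1 := by simp; norm_num
    rw [norm_smul, norm_mul, norm_mul, norm_pow]
    calc _ ≤ 1 * (1 * (‖(ascPochhammer ℂ r).eval (1 / 2 : ℂ) / r.factorial‖ * (κ ^ 2) ^ r)) := by
          gcongr
          exact hn p
      _ = _ := by ring
  · refine HasSum.const_smul _ ?_
    have h := (hasSum_one_sub_cpow_neg (1 / 2) ((hn p).trans_lt hκ)).mul_left (Complex.I / 2)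
    have e : greenSymbol κ 0 0 p = Complex.I / 2 *
        (1 - ((κ : ℂ) * circleCos p) ^ 2) ^ (-(1 / 2) : ℂ) := by
      have hs := dispersionRoot_ne_zero (one_sub_sq_mem_slitPlane_of_real hκ p)
      rw [Complex.cpow_neg, greenSymbol]
      simp only [waveSymbol, Complex.ofReal_zero, mul_zero, add_zero, Int.natAbs_zero,
        pow_zero] at hs ⊢
      rw [← dispersionRoot]
      field_simp
      linear_combination -Complex.I_sq
    rw [e]
    exact h

theorem latticeGreen_zero_odd {κ : ℝ} (hκ : κ ^ 2 < 1) {j : ℤ} (hj : Odd j) :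
    latticeGreen κ 0 j 0 = 0 := by
  refine (hasSum_latticeGreen_zero hκ j).unique (hasSum_zero.of_eq fun r => ?_)
  rw [fourierCoeff_circleCos_pow_odd r hj, mul_zero]

theorem latticeGreen_zero_even {κ : ℝ} (hκ : κ ^ 2 < 1) (k : ℤ) :
    latticeGreen κ 0 (2 * k) 0 = Complex.I / 2 * κ ^ (2 * k.natAbs) * (-1) ^ k.natAbs *
      ((genBinom (k.natAbs - 1 / 2) (2 * k.natAbs) : ℝ) : ℂ) *
        ₂F₁ (1 / 2 + k.natAbs : ℂ) (1 / 2 + k.natAbs) (1 + (2 * k.natAbs : ℕ)) ((κ : ℂ) ^ 2) := by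
  obtain ⟨K, hK⟩ : ∃ K, K = k.natAbs := ⟨_, rfl⟩
  rw [← hK]
  have h := hasSum_latticeGreen_zero hκ (2 * k)
  simp only [fourierCoeff_circleCos_pow_even, ← hK] at h
  -- The powers cos^(2r) with r < K have no Fourier mode 2K, so the sum effectively starts at r = K.
  have h1 := (hasSum_nat_add_iff' K).2 h
  rw [Finset.sum_eq_zero, sub_zero] at h1
  · have hc : ∀ s : ℕ, (1 + (2 * K : ℕ) : ℂ) + s ≠ 0 := fun s => by
      have := (2 * K + s).succ_ne_zero
      rw [add_assoc, add_comm]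
      exact_mod_cast this
    have h2 := hasSum_ordinaryHypergeometric (1 / 2 + K : ℂ) (1 / 2 + K) hc
      (w := (κ : ℂ) ^ 2) (by simpa using hκ)
    refine h1.unique ((h2.mul_left _).of_eq fun s => ?_)
    have e := half_ascPochhammer_mul_choose K s
    rw [show 2 * (s + K) = 2 * K + 2 * s by ring, pow_add, pow_mul _ 2 s] at *
    linear_combination Complex.I / 2 * κ ^ (2 * K) * (κ ^ 2) ^ s * e
  · intro r hr
    rw [Finset.mem_range] at hr
    rw [Nat.choose_eq_zero_of_lt (by omega)]
    simp

end GreenZero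

end

/-! ### Recurrences and initial row of the closed form -/

theorem gauss2F1_comm (a b c z : ℂ) : gauss2F1 a b c z = gauss2F1 b a c z := by
  have : (₂F₁ a b c : ℂ → ℂ) = ₂F₁ b a c := by
    unfold ordinaryHypergeometric
    rw [ordinaryHypergeometricSeries_symm]
  have e : IsGaussValue a b c z = IsGaussValue b a c z := by
    funext w
    rw [IsGaussValue, this, IsGaussValue]
  by_cases h : ∃ w, IsGaussValue a b c z w
  · obtain ⟨w, hw⟩ := h
    rw [hw.gauss2F1_eq, (e ▸ hw : IsGaussValue b a c z w).gauss2F1_eq]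
  · rw [gauss2F1, dif_neg h, gauss2F1, dif_neg (e ▸ h)]

section ClosedForm

/-- The closed form for the first component of the propagator at distance `l`, up to sign. -/
noncomputable def closedFst (μ : ℝ) (l : ℕ) (n : ℤ) : ℂ :=
  Complex.I * ((-Complex.I * μ) ^ (n - l) * (latticeCoupling μ 0 : ℂ) ^ n) *
    (genBinom ((n + l) / 2 - 1 / 2) l : ℂ) *
      gauss2F1 ((1 + l - n) / 2) ((1 + l - n) / 2) (1 + l) (-1 / μ ^ 2)

/-- The closed form for the second component of the propagator at distance `l`, up to sign;
here `θ` is `1` to the right of the source and `0` to the left. -/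
noncomputable def closedSnd (μ θ : ℝ) (l : ℕ) (n : ℤ) : ℂ :=
  ((-Complex.I * μ) ^ (n - l) * (latticeCoupling μ 0 : ℂ) ^ n) *
    (genBinom ((n + l) / 2 - 1 + θ) l : ℂ) *
      gauss2F1 ((l - n) / 2) ((l - n) / 2 + 1) (1 + l) (-1 / μ ^ 2)

variable {μ : ℝ}

/-- A normal form for comparing terms at neighbouring points: with p = -iμ the argument -1/μ²
becomes 1/p², and the terms share the powers p^e and κ^k, leaving a small exponent `i` and at most
one factor κ. -/
theorem closedFst_eq {l : ℕ} {n e k : ℤ} {i : ℕ} {β c p : ℂ} {N : ℝ} (hμ : 0 < μ)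
    (hp : p = -Complex.I * μ) (he : n - l = e + i) (hk : n = k + 1 ∨ n = k)
    (hβ : (1 + l - n) / 2 = β)
    (hN : ((n : ℝ) + l) / 2 - 1 / 2 = N) (hc : (1 + l : ℂ) = c) :
    closedFst μ l n = Complex.I * (p ^ e * p ^ i *
      ((latticeCoupling μ 0 : ℂ) ^ k * (if n = k then 1 else latticeCoupling μ 0))) *
      (genBinom N l : ℂ) * gauss2F1 β β c (1 / p ^ 2) := by
  have h0 : p ≠ 0 := by rw [hp]; simp [hμ.ne']
  have ha : (latticeCoupling μ 0 : ℂ) ≠ 0 := by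
    exact_mod_cast (latticeCoupling_pos (by norm_num)).ne'
  have hz : (-1 / μ ^ 2 : ℂ) = 1 / p ^ 2 := by
    rw [hp, mul_pow, neg_sq, Complex.I_sq]
    field_simp
  subst hβ hN hc
  rw [closedFst, ← hp, he, zpow_add₀ h0, zpow_natCast, hz]
  rcases hk with rfl | rfl
  · rw [zpow_add_one₀ ha, if_neg (by omega)]
  · rw [if_pos rfl, Complex.ofReal_one, mul_one]

theorem closedSnd_eq {θ : ℝ} {l : ℕ} {n e k : ℤ} {i : ℕ} {γ c p : ℂ} {N : ℝ} (hμ : 0 < μ)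
    (hp : p = -Complex.I * μ) (he : n - l = e + i) (hk : n = k + 1 ∨ n = k)
    (hγ : ((l : ℂ) - n) / 2 = γ)
    (hN : ((n : ℝ) + l) / 2 - 1 + θ = N) (hc : (1 + l : ℂ) = c) :
    closedSnd μ θ l n = (p ^ e * p ^ i *
      ((latticeCoupling μ 0 : ℂ) ^ k * (if n = k then 1 else latticeCoupling μ 0))) *
      (genBinom N l : ℂ) * gauss2F1 γ (γ + 1) c (1 / p ^ 2) := by
  have h0 : p ≠ 0 := by rw [hp]; simp [hμ.ne']
  have ha : (latticeCoupling μ 0 : ℂ) ≠ 0 := by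
    exact_mod_cast (latticeCoupling_pos (by norm_num)).ne'
  have hz : (-1 / μ ^ 2 : ℂ) = 1 / p ^ 2 := by
    rw [hp, mul_pow, neg_sq, Complex.I_sq]
    field_simp
  subst hγ hN hc
  rw [closedSnd, ← hp, he, zpow_add₀ h0, zpow_natCast, hz]
  rcases hk with rfl | rfl
  · rw [zpow_add_one₀ ha, if_neg (by omega)]
  · rw [if_pos rfl, Complex.ofReal_one, mul_one]

theorem one_add_natCast_add_ne_zero (l k : ℕ) : (1 + l : ℂ) + k ≠ 0 := by
  rw [add_assoc, add_comm]
  exact_mod_cast (l + k).succ_ne_zero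

theorem one_div_sq_re_lt (hμ : 0 < μ) {p : ℂ} (hp : p = -Complex.I * μ) :
    (1 / p ^ 2).re < 1 / 2 := by
  have hz : 1 / p ^ 2 = ((-1 / μ ^ 2 : ℝ) : ℂ) := by
    rw [hp, mul_pow, neg_sq, Complex.I_sq]
    push_cast
    field_simp
  rw [hz, Complex.ofReal_re]
  have : 0 < 1 / μ ^ 2 := by positivity
  rw [neg_div]
  linarith

/-- The first equation at j = l ≥ 0. Like the next three recurrences it ignores sign and source,
holds for every integer `n`, and reduces to one contiguous relation. -/
theorem closedFst_succ_time_right (hμ : 0 < μ) (l : ℕ) (n : ℤ) :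
    closedFst μ l n = latticeCoupling μ 0 *
      (closedFst μ (l + 1) (n - 1) + μ * closedSnd μ 1 l (n - 1)) := by
  obtain ⟨p, hp⟩ : ∃ p, p = -Complex.I * μ := ⟨_, rfl⟩
  have hμp : (μ : ℂ) = Complex.I * p := by linear_combination μ * Complex.I_sq - Complex.I * hp
  have h0 : p ≠ 0 := by rw [hp]; simp [hμ.ne']
  obtain ⟨β, hβ⟩ : ∃ β : ℂ, (1 + l - n) / 2 = β := ⟨_, rfl⟩
  obtain ⟨N, hN⟩ : ∃ N : ℝ, ((n : ℝ) + l) / 2 - 1 / 2 = N := ⟨_, rfl⟩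
  have hNβ : (N : ℂ) - l = -β := by rw [← hN, ← hβ]; push_cast; ring
  have hc := one_add_natCast_add_ne_zero l
  have hc0 : (1 + l : ℂ) ≠ 0 := by simpa using hc 0
  rw [closedFst_eq hμ hp (e := n - l - 2) (i := 2) (k := n - 1) (by push_cast; ring)
      (Or.inl (by ring)) hβ hN rfl, if_neg (by omega),
    closedFst_eq hμ hp (e := n - l - 2) (i := 0) (k := n - 1) (β := β + 1) (N := N)
      (c := 1 + l + 1) (by push_cast; ring) (Or.inr rfl) (by rw [← hβ]; push_cast; ring)
      (by rw [← hN]; push_cast; ring) (by push_cast; ring), if_pos rfl,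
    closedSnd_eq hμ hp (e := n - l - 2) (i := 1) (k := n - 1) (γ := β) (N := N)
      (c := 1 + l) (by push_cast; ring) (Or.inr rfl) (by rw [← hβ]; push_cast; ring)
      (by rw [← hN]; push_cast; ring) rfl, if_pos rfl, genBinom_succ, hμp]
  have rel := gauss2F1_contiguous_upper β β hc (one_div_sq_re_lt hμ hp)
  rw [gauss2F1_comm (β + 1) β] at rel
  push_cast
  rw [hNβ, add_comm (l : ℂ) 1]
  generalize gauss2F1 β β (1 + l) (1 / p ^ 2) = g1 at *
  generalize gauss2F1 β (β + 1) (1 + l) (1 / p ^ 2) = g2 at *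
  generalize gauss2F1 (β + 1) (β + 1) (1 + l + 1) (1 / p ^ 2) = g3 at *
  field_simp at rel ⊢
  linear_combination -(latticeCoupling μ 0 : ℂ) ^ (n - 1) * latticeCoupling μ 0 * genBinom N l * rel

theorem closedSnd_succ_succ_time (hμ : 0 < μ) (l : ℕ) (n : ℤ) :
    closedSnd μ 1 (l + 1) n = latticeCoupling μ 0 *
      (closedSnd μ 1 l (n - 1) - μ * closedFst μ (l + 1) (n - 1)) := by
  obtain ⟨p, hp⟩ : ∃ p, p = -Complex.I * μ := ⟨_, rfl⟩
  have hμp : (μ : ℂ) = Complex.I * p := by linear_combination μ * Complex.I_sq - Complex.I * hp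
  have h0 : p ≠ 0 := by rw [hp]; simp [hμ.ne']
  obtain ⟨β, hβ⟩ : ∃ β : ℂ, (l + 1 - n) / 2 = β := ⟨_, rfl⟩
  obtain ⟨N, hN⟩ : ∃ N : ℝ, ((n : ℝ) + l - 1) / 2 = N := ⟨_, rfl⟩
  have hN1 : (N : ℂ) + 1 = 1 + l - β := by rw [← hN, ← hβ]; push_cast; ring
  have hN2 : (N : ℂ) - l = -β := by rw [← hN, ← hβ]; push_cast; ring
  have hc := one_add_natCast_add_ne_zero l
  have hc0 : (1 + l : ℂ) ≠ 0 := by simpa using hc 0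
  rw [closedSnd_eq hμ hp (e := n - l - 2) (i := 1) (k := n - 1) (γ := β) (N := N + 1)
      (c := 1 + l + 1) (by push_cast; ring) (Or.inl (by ring)) (by rw [← hβ]; push_cast; ring)
      (by rw [← hN]; push_cast; ring) (by push_cast; ring), if_neg (by omega),
    closedSnd_eq hμ hp (e := n - l - 2) (i := 1) (k := n - 1) (γ := β) (N := N)
      (c := 1 + l) (by push_cast; ring) (Or.inr rfl) (by rw [← hβ]; push_cast; ring)
      (by rw [← hN]; push_cast; ring) (by ring), if_pos rfl,
    closedFst_eq hμ hp (e := n - l - 2) (i := 0) (k := n - 1) (β := β + 1) (N := N)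
      (c := 1 + l + 1) (by push_cast; ring) (Or.inr rfl) (by rw [← hβ]; push_cast; ring)
      (by rw [← hN]; push_cast; ring) (by push_cast; ring), if_pos rfl, genBinom_succ N,
    genBinom_add_one_succ, hμp]
  have rel := gauss2F1_contiguous_lower (β + 1) β hc (one_div_sq_re_lt hμ hp)
  rw [gauss2F1_comm (β + 1) β, gauss2F1_comm (β + 1) β] at rel
  push_cast
  rw [hN1, hN2, add_comm (l : ℂ) 1]
  generalize gauss2F1 β (β + 1) (1 + l) (1 / p ^ 2) = g1 at *
  generalize gauss2F1 β (β + 1) (1 + l + 1) (1 / p ^ 2) = g2 at *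
  generalize gauss2F1 (β + 1) (β + 1) (1 + l + 1) (1 / p ^ 2) = g3 at *
  field_simp at rel ⊢
  linear_combination -(latticeCoupling μ 0 : ℂ) ^ (n - 1) * latticeCoupling μ 0 * genBinom N l *
    (rel + β * g3 * Complex.I_sq)

theorem closedFst_succ_succ_time (hμ : 0 < μ) (l : ℕ) (n : ℤ) :
    closedFst μ (l + 1) n = latticeCoupling μ 0 *
      (closedFst μ l (n - 1) + μ * closedSnd μ 0 (l + 1) (n - 1)) := by
  obtain ⟨p, hp⟩ : ∃ p, p = -Complex.I * μ := ⟨_, rfl⟩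
  have hμp : (μ : ℂ) = Complex.I * p := by linear_combination μ * Complex.I_sq - Complex.I * hp
  have h0 : p ≠ 0 := by rw [hp]; simp [hμ.ne']
  obtain ⟨β, hβ⟩ : ∃ β : ℂ, ((l : ℂ) + 2 - n) / 2 = β := ⟨_, rfl⟩
  obtain ⟨N, hN⟩ : ∃ N : ℝ, ((n : ℝ) + l) / 2 - 1 = N := ⟨_, rfl⟩
  have hN1 : (N : ℂ) + 1 = 1 + l - β := by rw [← hN, ← hβ]; push_cast; ring
  have hN2 : (N : ℂ) - l = -β := by rw [← hN, ← hβ]; push_cast; ring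
  have hc := one_add_natCast_add_ne_zero l
  have hc0 : (1 + l : ℂ) ≠ 0 := by simpa using hc 0
  rw [closedFst_eq hμ hp (e := n - l - 2) (i := 1) (k := n - 1) (β := β) (N := N + 1)
      (c := 1 + l + 1) (by push_cast; ring) (Or.inl (by ring)) (by rw [← hβ]; push_cast; ring)
      (by rw [← hN]; push_cast; ring) (by push_cast; ring), if_neg (by omega),
    closedFst_eq hμ hp (e := n - l - 2) (i := 1) (k := n - 1) (β := β) (N := N)
      (c := 1 + l) (by push_cast; ring) (Or.inr rfl) (by rw [← hβ]; push_cast; ring)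
      (by rw [← hN]; push_cast; ring) (by ring), if_pos rfl,
    closedSnd_eq hμ hp (e := n - l - 2) (i := 0) (k := n - 1) (γ := β) (N := N)
      (c := 1 + l + 1) (by push_cast; ring) (Or.inr rfl) (by rw [← hβ]; push_cast; ring)
      (by rw [← hN]; push_cast; ring) (by push_cast; ring), if_pos rfl, genBinom_succ N,
    genBinom_add_one_succ, hμp]
  have rel := gauss2F1_contiguous_lower β β hc (one_div_sq_re_lt hμ hp)
  push_cast
  rw [hN1, hN2, add_comm (l : ℂ) 1]
  generalize gauss2F1 β β (1 + l) (1 / p ^ 2) = g1 at *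
  generalize gauss2F1 β β (1 + l + 1) (1 / p ^ 2) = g2 at *
  generalize gauss2F1 β (β + 1) (1 + l + 1) (1 / p ^ 2) = g3 at *
  field_simp at rel ⊢
  linear_combination -(latticeCoupling μ 0 : ℂ) ^ (n - 1) * latticeCoupling μ 0 * genBinom N l * rel

theorem closedSnd_succ_time_left (hμ : 0 < μ) (l : ℕ) (n : ℤ) :
    closedSnd μ 0 l n = latticeCoupling μ 0 *
      (closedSnd μ 0 (l + 1) (n - 1) - μ * closedFst μ l (n - 1)) := by
  obtain ⟨p, hp⟩ : ∃ p, p = -Complex.I * μ := ⟨_, rfl⟩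
  have hμp : (μ : ℂ) = Complex.I * p := by linear_combination μ * Complex.I_sq - Complex.I * hp
  have h0 : p ≠ 0 := by rw [hp]; simp [hμ.ne']
  obtain ⟨β, hβ⟩ : ∃ β : ℂ, ((l : ℂ) - n) / 2 = β := ⟨_, rfl⟩
  obtain ⟨N, hN⟩ : ∃ N : ℝ, ((n : ℝ) + l) / 2 - 1 = N := ⟨_, rfl⟩
  have hN2 : (N : ℂ) - l = -(β + 1) := by rw [← hN, ← hβ]; push_cast; ring
  have hc := one_add_natCast_add_ne_zero l
  have hc0 : (1 + l : ℂ) ≠ 0 := by simpa using hc 0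
  rw [closedSnd_eq hμ hp (e := n - l - 2) (i := 2) (k := n - 1) (γ := β) (N := N)
      (c := 1 + l) (by push_cast; ring) (Or.inl (by ring)) (by rw [← hβ])
      (by rw [← hN]; ring) (by ring), if_neg (by omega),
    closedSnd_eq hμ hp (e := n - l - 2) (i := 0) (k := n - 1) (γ := β + 1) (N := N)
      (c := 1 + l + 1) (by push_cast; ring) (Or.inr rfl) (by rw [← hβ]; push_cast; ring)
      (by rw [← hN]; push_cast; ring) (by push_cast; ring), if_pos rfl,
    closedFst_eq hμ hp (e := n - l - 2) (i := 1) (k := n - 1) (β := β + 1) (N := N)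
      (c := 1 + l) (by push_cast; ring) (Or.inr rfl) (by rw [← hβ]; push_cast; ring)
      (by rw [← hN]; push_cast; ring) (by ring), if_pos rfl, genBinom_succ N, hμp]
  have rel := gauss2F1_contiguous_upper β (β + 1) hc (one_div_sq_re_lt hμ hp)
  push_cast
  rw [hN2, add_comm (l : ℂ) 1]
  generalize gauss2F1 β (β + 1) (1 + l) (1 / p ^ 2) = g1 at *
  generalize gauss2F1 (β + 1) (β + 1 + 1) (1 + l + 1) (1 / p ^ 2) = g2 at *
  generalize gauss2F1 (β + 1) (β + 1) (1 + l) (1 / p ^ 2) = g3 at *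
  field_simp at rel ⊢
  linear_combination -(latticeCoupling μ 0 : ℂ) ^ (n - 1) * latticeCoupling μ 0 * genBinom N l *
    (rel - p ^ 2 * (1 + l) * g3 * Complex.I_sq)

/-- For l = 2k + 1 the upper entry of the binomial is the natural number k < l. -/
theorem closedFst_odd_zero {l : ℕ} (hl : Odd l) : closedFst μ l 0 = 0 := by
  obtain ⟨k, rfl⟩ := hl
  have e : (((0 : ℤ) : ℝ) + (2 * k + 1 : ℕ)) / 2 - 1 / 2 = (k : ℕ) := by push_cast; ring
  rw [closedFst, e, genBinom_natCast_eq_zero (by omega)]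
  simp

theorem closedSnd_zero_zero (hμ : 0 < μ) (θ : ℝ) : closedSnd μ θ 0 0 = 1 := by
  have hz : (-1 / μ ^ 2 : ℂ).re < 1 / 2 := by
    have := one_div_sq_re_lt hμ rfl
    rwa [mul_pow, neg_sq, Complex.I_sq, neg_one_mul, div_neg, ← neg_div] at this
  have hc : ∀ k : ℕ, (1 : ℂ) + k ≠ 0 := fun k => by simpa using one_add_natCast_add_ne_zero 0 k
  have h := hasSum_ordinaryHypergeometric 0 (1 - 1) hc (norm_div_sub_one_lt_one hz)
  have h2 := h.unique (hasSum_single 0 fun k hk => by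
    simp [ordinaryHypergeometricCoefficient, hk])
  simp only [closedSnd, Nat.cast_zero, Int.cast_zero, sub_zero, zero_div, zero_add, add_zero,
    zpow_zero, genBinom_zero_right, Complex.ofReal_one, one_mul]
  rw [gauss2F1_pfaff 0 1 hc hz, h2]
  simp [ordinaryHypergeometricCoefficient, ascPochhammer_zero]

/-- This is the counterpart of `greenField_zero_snd_zero`, and follows by combining both contiguous
relations. The change of sign between θ = 1 and θ = 0 sits in the binomials alone: at time 0 they
differ by the ratio of (l+1)/2 to -(l+1)/2. -/
theorem closedSnd_succ_zero (hμ : 0 < μ) (l : ℕ) :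
    closedSnd μ 1 (l + 1) 0 = (closedFst μ l 0 - closedFst μ (l + 2) 0) / (2 * μ) ∧
    closedSnd μ 0 (l + 1) 0 = -closedSnd μ 1 (l + 1) 0 := by
  obtain ⟨p, hp⟩ : ∃ p, p = -Complex.I * μ := ⟨_, rfl⟩
  have hμp : (μ : ℂ) = Complex.I * p := by linear_combination μ * Complex.I_sq - Complex.I * hp
  have h0 : p ≠ 0 := by rw [hp]; simp [hμ.ne']
  obtain ⟨h, hh⟩ : ∃ h : ℂ, (1 + l : ℂ) / 2 = h := ⟨_, rfl⟩
  have hl : (1 + l : ℂ) = 2 * h := by rw [← hh]; ring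
  have hl' : (l : ℂ) = 2 * h - 1 := by rw [← hl]; ring
  have hc := one_add_natCast_add_ne_zero l
  have hc' := add_natCast_ne_zero_succ hc
  have h2 : 2 * h + 1 ≠ 0 := by rw [← hl]; simpa using hc 1
  have hne : h ≠ 0 := by
    intro e
    have := hc 0
    rw [hl, e] at this
    simp at this
  have r1 := gauss2F1_contiguous_lower h h hc (one_div_sq_re_lt hμ hp)
  have r2 := gauss2F1_contiguous_upper h h hc' (one_div_sq_re_lt hμ hp)
  rw [gauss2F1_comm (h + 1) h] at r2
  rw [closedSnd_eq hμ hp (e := -l - 2) (i := 1) (k := 0) (γ := h) (N := ((l : ℝ) - 1) / 2 + 1)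
      (c := 1 + l + 1) (by push_cast; ring) (Or.inr rfl) (by rw [← hh]; push_cast; ring)
      (by push_cast; ring) (by push_cast; ring),
    closedSnd_eq hμ hp (e := -l - 2) (i := 1) (k := 0) (γ := h) (N := ((l : ℝ) - 1) / 2)
      (c := 1 + l + 1) (by push_cast; ring) (Or.inr rfl) (by rw [← hh]; push_cast; ring)
      (by push_cast; ring) (by push_cast; ring),
    closedFst_eq hμ hp (e := -l - 2) (i := 2) (k := 0) (β := h) (N := ((l : ℝ) - 1) / 2)
      (c := 1 + l) (by push_cast; ring) (Or.inr rfl) (by rw [← hh]; push_cast; ring)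
      (by push_cast; ring) (by ring),
    closedFst_eq hμ hp (e := -l - 2) (i := 0) (k := 0) (β := h + 1) (N := ((l : ℝ) - 1) / 2 + 1)
      (c := 1 + l + 1 + 1) (by push_cast; ring) (Or.inr rfl) (by rw [← hh]; push_cast; ring)
      (by push_cast; ring) (by push_cast; ring), genBinom_succ _ (l + 1),
    genBinom_add_one_succ, genBinom_succ, hμp]
  push_cast
  rw [hl'] at r1 r2 ⊢
  rw [show 1 + (2 * h - 1) = 2 * h by ring] at *
  generalize gauss2F1 h (h + 1) (2 * h + 1) (1 / p ^ 2) = g1 at *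
  generalize gauss2F1 h h (2 * h) (1 / p ^ 2) = g2 at *
  generalize gauss2F1 h h (2 * h + 1) (1 / p ^ 2) = g3 at *
  generalize gauss2F1 (h + 1) (h + 1) (2 * h + 1 + 1) (1 / p ^ 2) = g4 at *
  have h2' : 2 * h - 1 + 1 + 1 ≠ 0 := by rwa [sub_add_cancel]
  simp only [sub_add_cancel] at *
  constructor
  · field_simp at r1 r2 ⊢
    linear_combination 4 * h * genBinom (((l : ℝ) - 1) / 2) l *
      (r2 - p ^ 2 * (2 * h + 1) * r1)
  · field_simp
    ring

/-- Pfaff's transformation moves the argument -1/μ² to 1/(1+μ²) = κ², where the Green function has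
its series. It keeps the parameters (1/2+K, 1/2+K; 1+2K), and its prefactor is (κμ)^(2K+1). -/
theorem closedFst_even_zero (hμ : 0 < μ) (k : ℤ) : closedFst μ (2 * k.natAbs) 0 =
    2 * latticeCoupling μ 0 * μ * latticeGreen (latticeCoupling μ 0) 0 (2 * k) 0 := by
  obtain ⟨a, ha⟩ : ∃ a, a = latticeCoupling μ 0 := ⟨_, rfl⟩
  obtain ⟨K, hK⟩ : ∃ K, K = k.natAbs := ⟨_, rfl⟩
  have ha0 : 0 < a := ha ▸ latticeCoupling_pos (by norm_num)
  have ha1 : a ^ 2 * (1 + μ ^ 2) = 1 := by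
    have := latticeCoupling_sq_mul (μ := μ) (δ := 0) (by norm_num)
    rw [← ha] at this
    linarith
  have ha1' : (a : ℂ) ^ 2 * (1 + μ ^ 2) = 1 := by exact_mod_cast ha1
  have hμ' : (μ : ℂ) ≠ 0 := by exact_mod_cast hμ.ne'
  have ha' : (a : ℂ) ≠ 0 := by exact_mod_cast ha0.ne'
  have hz : (-1 / μ ^ 2 : ℂ).re < 1 / 2 := by
    have := one_div_sq_re_lt hμ rfl
    rwa [mul_pow, neg_sq, Complex.I_sq, neg_one_mul, div_neg, ← neg_div] at this
  have hw : (-1 / μ ^ 2 : ℂ) / (-1 / μ ^ 2 - 1) = a ^ 2 := by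
    have h1 : (1 + μ ^ 2 : ℂ) ≠ 0 := right_ne_zero_of_mul (ha1'.trans_ne one_ne_zero)
    have h2 : (-1 / μ ^ 2 - 1 : ℂ) = -(1 + μ ^ 2) / μ ^ 2 := by field_simp; ring
    rw [h2]
    field_simp
    linear_combination -ha1'
  have hpow : (1 - -1 / μ ^ 2 : ℂ) ^ (-(1 / 2 + K) : ℂ) = (a * μ) ^ (2 * K + 1) := by
    have h1 : (1 - -1 / μ ^ 2 : ℂ) = ((((a * μ) ^ 2)⁻¹ : ℝ) : ℂ) := by
      push_cast
      field_simp
      linear_combination ha1'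
    have h2 : (((a * μ) ^ 2)⁻¹ : ℝ) ^ (-(1 / 2 + K) : ℝ) = (a * μ) ^ (2 * K + 1) := by
      have h3 : 0 < a * μ := mul_pos ha0 hμ
      rw [Real.rpow_neg (by positivity), Real.inv_rpow (by positivity), inv_inv,
        ← Real.rpow_natCast, ← Real.rpow_mul h3.le, ← Real.rpow_natCast]
      congr 1
      push_cast
      ring
    rw [h1, show (-(1 / 2 + K) : ℂ) = ((-(1 / 2 + K) : ℝ) : ℂ) by push_cast; ring,
      ← Complex.ofReal_cpow (by positivity), h2]
    push_cast
    ring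
  have hc := one_add_natCast_add_ne_zero (2 * K)
  rw [latticeGreen_zero_even (latticeCoupling_zero_sq_lt_one hμ), closedFst, ← ha, ← hK,
    show ((1 + (2 * K : ℕ) - (0 : ℤ)) / 2 : ℂ) = 1 / 2 + K by push_cast; ring,
    show (((0 : ℤ) : ℝ) + (2 * K : ℕ)) / 2 - 1 / 2 = K - 1 / 2 by push_cast; ring,
    gauss2F1_pfaff _ _ hc hz, hw, hpow,
    show (1 + (2 * K : ℕ) - (1 / 2 + K) : ℂ) = 1 / 2 + K by push_cast; ring,
    zero_sub, zpow_neg, zpow_natCast, zpow_zero, pow_mul (-Complex.I * (μ : ℂ)), mul_pow,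
    neg_sq, Complex.I_sq, mul_pow (-1 : ℂ), mul_inv, ← inv_pow (-1 : ℂ), inv_neg_one]
  field_simp
  ring

end ClosedForm

/-! ### Signs, the source, and identification of the limit -/

section Assembly

variable {μ : ℝ}

theorem heavisideStep_of_nonneg {x : ℝ} (h : 0 ≤ x) : heavisideStep x = 1 := if_pos h

theorem heavisideStep_of_neg {x : ℝ} (h : x < 0) : heavisideStep x = 0 := if_neg h.not_ge

theorem closedFst_natAbs (hμ : 0 < μ) (j n : ℤ) :
    closedFst μ j.natAbs n = latticeCoupling μ 0 * (closedFst μ (j + 1).natAbs (n - 1) +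
      μ * closedSnd μ (heavisideStep j) j.natAbs (n - 1)) := by
  rcases lt_or_ge j 0 with h | h
  · obtain ⟨l, rfl⟩ : ∃ l : ℕ, j = -(l + 1) := ⟨(-j - 1).toNat, by omega⟩
    rw [heavisideStep_of_neg (by exact_mod_cast h), show (-((l : ℤ) + 1)).natAbs = l + 1 by omega,
      show (-((l : ℤ) + 1) + 1).natAbs = l by omega]
    exact closedFst_succ_succ_time hμ l n
  · obtain ⟨l, rfl⟩ := Int.eq_ofNat_of_zero_le h
    rw [heavisideStep_of_nonneg (by exact_mod_cast h), Int.natAbs_natCast,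
      show ((l : ℤ) + 1).natAbs = l + 1 by omega]
    exact closedFst_succ_time_right hμ l n

theorem closedSnd_natAbs (hμ : 0 < μ) (j n : ℤ) :
    closedSnd μ (heavisideStep j) j.natAbs n =
      latticeCoupling μ 0 * (closedSnd μ (heavisideStep (j - 1 : ℤ)) (j - 1).natAbs (n - 1) -
        μ * closedFst μ j.natAbs (n - 1)) := by
  rcases lt_or_ge 0 j with h | h
  · obtain ⟨l, rfl⟩ : ∃ l : ℕ, j = l + 1 := ⟨(j - 1).toNat, by omega⟩
    rw [heavisideStep_of_nonneg (by exact_mod_cast h.le),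
      heavisideStep_of_nonneg (by push_cast; simp), add_sub_cancel_right, Int.natAbs_natCast,
      show ((l : ℤ) + 1).natAbs = l + 1 by omega]
    exact closedSnd_succ_succ_time hμ l n
  · obtain ⟨l, rfl⟩ : ∃ l : ℕ, j = -l := ⟨(-j).toNat, by omega⟩
    have e : closedSnd μ (heavisideStep ((-l : ℤ) : ℝ)) (-(l : ℤ)).natAbs n =
        closedSnd μ 0 l n := by
      rw [Int.natAbs_neg, Int.natAbs_natCast]
      rcases Nat.eq_zero_or_pos l with rfl | hl
      -- At the origin the step function is 1 rather than 0, but a binomial with lower entry 0 does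
      -- not see it.
      · simp [closedSnd, genBinom_zero_right]
      · rw [heavisideStep_of_neg (by push_cast; simpa using hl)]
    rw [e, heavisideStep_of_neg (by push_cast; linarith [(l.cast_nonneg : (0 : ℝ) ≤ l)]),
      show (-(l : ℤ) - 1).natAbs = l + 1 by omega, Int.natAbs_neg, Int.natAbs_natCast]
    exact closedSnd_succ_time_left hμ l n

theorem closedFst_natAbs_odd_zero {j : ℤ} (hj : Odd j) : closedFst μ j.natAbs 0 = 0 :=
  closedFst_odd_zero (Int.natAbs_odd.2 hj)

theorem closedFst_natAbs_zero (hμ : 0 < μ) (j : ℤ) : closedFst μ j.natAbs 0 =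
    2 * latticeCoupling μ 0 * μ * latticeGreen (latticeCoupling μ 0) 0 j 0 := by
  rcases Int.even_or_odd' j with ⟨k, rfl | rfl⟩
  · rw [← closedFst_even_zero hμ k, Int.natAbs_mul]
    rfl
  · have h : Odd (2 * k + 1) := ⟨k, rfl⟩
    rw [closedFst_natAbs_odd_zero h,
      latticeGreen_zero_odd (latticeCoupling_zero_sq_lt_one hμ) h, mul_zero]

theorem closedSnd_natAbs_zero (hμ : 0 < μ) (j : ℤ) :
    closedSnd μ (heavisideStep j) j.natAbs 0 = (if j = 0 then 1 else 0) +
      (closedFst μ (j - 1).natAbs 0 - closedFst μ (j + 1).natAbs 0) / (2 * μ) := by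
  rcases lt_trichotomy j 0 with h | rfl | h
  · obtain ⟨l, rfl⟩ : ∃ l : ℕ, j = -(l + 1) := ⟨(-j - 1).toNat, by omega⟩
    rw [heavisideStep_of_neg (by exact_mod_cast h), if_neg (by omega),
      show (-((l : ℤ) + 1)).natAbs = l + 1 by omega,
      show (-((l : ℤ) + 1) - 1).natAbs = l + 2 by omega,
      show (-((l : ℤ) + 1) + 1).natAbs = l by omega, (closedSnd_succ_zero hμ l).2,
      (closedSnd_succ_zero hμ l).1]
    ring
  · simp [closedSnd_zero_zero hμ]
  · obtain ⟨l, rfl⟩ : ∃ l : ℕ, j = l + 1 := ⟨(j - 1).toNat, by omega⟩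
    rw [heavisideStep_of_nonneg (by exact_mod_cast h.le), if_neg (by omega),
      show ((l : ℤ) + 1).natAbs = l + 1 by omega,
      show ((l : ℤ) + 1 - 1).natAbs = l by omega,
      show ((l : ℤ) + 1 + 1).natAbs = l + 2 by omega, (closedSnd_succ_zero hμ l).1]
    ring

theorem closedSnd_natAbs_even_zero (hμ : 0 < μ) {j : ℤ} (hj : Even j) :
    closedSnd μ (heavisideStep j) j.natAbs 0 = if j = 0 then 1 else 0 := by
  rw [closedSnd_natAbs_zero hμ, closedFst_natAbs_odd_zero (hj.sub_odd odd_one),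
    closedFst_natAbs_odd_zero (hj.add_odd odd_one)]
  simp

/-- The sign in the closed form. -/
noncomputable def propagatorSign (s n : ℤ) : ℂ := if n < 0 ∧ Even s then -1 else 1

/-- Along each equation the parity of `s` is the same for all terms, so the sign factors out, except
between the rows -1 and 0 when `s` is even. -/
theorem propagatorSign_congr {s s' n : ℤ} (h : Even (s - s')) (hn : n ≠ 0 ∨ Odd s) :
    propagatorSign s' (n - 1) = propagatorSign s n := by
  unfold propagatorSign
  rw [Int.even_sub] at h
  rw [← Int.not_even_iff_odd] at hn
  have e : (n - 1 < 0 ∧ Even s') ↔ (n < 0 ∧ Even s) := by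
    constructor
    · rintro ⟨h1, h2⟩
      refine ⟨?_, h.2 h2⟩
      have := hn.resolve_right (not_not.2 (h.2 h2))
      omega
    · rintro ⟨h1, h2⟩
      exact ⟨by omega, h.1 h2⟩
  simp only [e]

theorem propagatorSign_zero (s : ℤ) : propagatorSign s 0 = 1 := by
  simp [propagatorSign]

theorem propagatorSign_even_neg_one {s : ℤ} (hs : Even s) : propagatorSign s (0 - 1) = -1 := by
  simp [propagatorSign, hs]

/-- The closed form of the propagator. -/
noncomputable def closedField (μ : ℝ) : (ℤ → ℤ → ℂ) × (ℤ → ℤ → ℂ) :=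
  (fun j n => propagatorSign (j + n + 1) n * closedFst μ j.natAbs n,
    fun j n => propagatorSign (j + n + 2) n * closedSnd μ (heavisideStep j) j.natAbs n)

theorem isLatticeField_closedField (hμ : 0 < μ) :
    IsLatticeField (latticeCoupling μ 0) μ 0 (closedField μ) := by
  constructor
  · intro j n
    have h := closedFst_natAbs hμ j n
    have e1 : Even (j + n + 1 - (j + 1 + (n - 1) + 1)) := ⟨0, by ring⟩
    have e2 : Even (j + n + 1 - (j + (n - 1) + 2)) := ⟨0, by ring⟩
    simp only [closedField, Complex.ofReal_zero, mul_zero, zero_mul, sub_zero, add_zero]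
    by_cases hn : n ≠ 0 ∨ Odd (j + n + 1)
    · rw [propagatorSign_congr e1 hn, propagatorSign_congr e2 hn]
      linear_combination propagatorSign (j + n + 1) n * h
    -- The sign flips here, but j is odd, so both sides are zero.
    · rw [not_or, not_not, Int.not_odd_iff_even] at hn
      obtain ⟨rfl, hn⟩ := hn
      have h1 : closedFst μ j.natAbs 0 = 0 :=
        closedFst_natAbs_odd_zero (by simpa [Int.even_add_one] using hn)
      rw [propagatorSign_zero, propagatorSign_even_neg_one ((Int.even_sub.1 e1).1 hn),
        propagatorSign_even_neg_one ((Int.even_sub.1 e2).1 hn)]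
      linear_combination 2 * h1 - h
  · intro j n
    have h := closedSnd_natAbs hμ j n
    have e1 : Even (j + n + 2 - (j - 1 + (n - 1) + 2)) := ⟨1, by ring⟩
    have e2 : Even (j + n + 2 - (j + (n - 1) + 1)) := ⟨1, by ring⟩
    simp only [closedField, Complex.ofReal_zero, mul_zero, zero_mul, sub_zero, add_zero]
    by_cases hn : n ≠ 0 ∨ Odd (j + n + 2)
    · have hs : (2 * (if j = 0 then 1 else 0) * (if n = 0 then 1 else 0) : ℂ) = 0 := by
        rcases hn with hn | hn
        · simp [hn]
        · by_cases hj : j = 0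
          · have : n ≠ 0 := by
              rintro rfl
              subst hj
              exact absurd hn (by decide)
            simp [this]
          · simp [hj]
      rw [hs, propagatorSign_congr e1 hn, propagatorSign_congr e2 hn]
      linear_combination propagatorSign (j + n + 2) n * h
    -- Here j is even and the unsigned value is 1 at the origin and 0 elsewhere. The flipped sign
    -- gives -1 at the origin, and the source 2 restores 1.
    · rw [not_or, not_not, Int.not_odd_iff_even] at hn
      obtain ⟨rfl, hn⟩ := hn
      have h1 := closedSnd_natAbs_even_zero hμ (j := j) (by
        have := hn.sub (even_two (α := ℤ))
        simpa using this)
      rw [propagatorSign_zero, propagatorSign_even_neg_one ((Int.even_sub.1 e1).1 hn),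
        propagatorSign_even_neg_one ((Int.even_sub.1 e2).1 hn), if_pos rfl]
      linear_combination 2 * h1 - h

theorem closedField_zero (hμ : 0 < μ) (j : ℤ) :
    (closedField μ).1 j 0 = (greenField (latticeCoupling μ 0) μ 0).1 j 0 ∧
    (closedField μ).2 j 0 = (greenField (latticeCoupling μ 0) μ 0).2 j 0 := by
  have hμ' : (μ : ℂ) ≠ 0 := by exact_mod_cast hμ.ne'
  rw [greenField_zero_snd_zero hμ]
  simp only [closedField, propagatorSign_zero, one_mul, closedSnd_natAbs_zero hμ,
    closedFst_natAbs_zero hμ]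
  constructor
  · simp [greenField]
    ring
  · field_simp

/-- The equations propagate forward in time by themselves; as the one-step matrix has determinant 1
by `hκ`, they can also be solved for the earlier row. -/
theorem IsLatticeField.eq_of_time_zero {κ : ℝ} (hκ : κ ^ 2 * (1 + μ ^ 2) = 1)
    {a b : (ℤ → ℤ → ℂ) × (ℤ → ℤ → ℂ)} (ha : IsLatticeField κ μ 0 a) (hb : IsLatticeField κ μ 0 b)
    (h : ∀ j, a.1 j 0 = b.1 j 0 ∧ a.2 j 0 = b.2 j 0) (n : ℤ) :
    ∀ j, a.1 j n = b.1 j n ∧ a.2 j n = b.2 j n := by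
  have hκ' : (κ : ℂ) ^ 2 * (1 + μ ^ 2) = 1 := by exact_mod_cast hκ
  induction n using Int.induction_on with
  | zero => exact h
  | succ k ih =>
    intro j
    constructor
    · rw [ha.fst j ((k : ℤ) + 1), hb.fst j ((k : ℤ) + 1), add_sub_cancel_right,
        (ih j).1, (ih j).2, (ih (j + 1)).1, (ih (j + 1)).2]
    · rw [ha.snd j ((k : ℤ) + 1), hb.snd j ((k : ℤ) + 1), add_sub_cancel_right,
        (ih j).1, (ih j).2, (ih (j - 1)).1, (ih (j - 1)).2]
  | pred k ih =>
    have back : ∀ {c : (ℤ → ℤ → ℂ) × (ℤ → ℤ → ℂ)}, IsLatticeField κ μ 0 c → ∀ j n : ℤ,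
        c.1 j (n - 1) = κ * (c.1 (j - 1) n - μ * (c.2 j n -
          2 * (if j = 0 then 1 else 0) * (if n = 0 then 1 else 0))) ∧
        c.2 j (n - 1) = κ * (c.2 (j + 1) n -
          2 * (if j + 1 = 0 then 1 else 0) * (if n = 0 then 1 else 0) + μ * c.1 j n) := by
      intro c hc j n
      have h1 := hc.fst (j - 1) n
      have h2 := hc.snd j n
      have h3 := hc.fst j n
      have h4 := hc.snd (j + 1) n
      simp only [sub_add_cancel, add_sub_cancel_right, Complex.ofReal_zero, mul_zero, zero_mul,
        sub_zero, add_zero] at h1 h2 h3 h4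
      constructor
      · linear_combination -κ * h1 + κ * μ * h2 - c.1 j (n - 1) * hκ'
      · linear_combination -κ * h4 - κ * μ * h3 - c.2 j (n - 1) * hκ'
    intro j
    rw [(back ha j _).1, (back ha j _).2, (back hb j _).1, (back hb j _).2]
    simp only [fun j => (ih j).1, fun j => (ih j).2, and_self]

theorem greenField_eq_closedField (hμ : 0 < μ) (j n : ℤ) :
    (greenField (latticeCoupling μ 0) μ 0).1 j n = (closedField μ).1 j n ∧
    (greenField (latticeCoupling μ 0) μ 0).2 j n = (closedField μ).2 j n := by
  refine (isLatticeField_greenField_zero hμ).eq_of_time_zero ?_ (isLatticeField_closedField hμ)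
    (fun j => ⟨(closedField_zero hμ j).1.symm, (closedField_zero hμ j).2.symm⟩) n j
  have := latticeCoupling_sq_mul (μ := μ) (δ := 0) (by norm_num)
  linarith

theorem latticeCoupling_zero_zpow (μ : ℝ) (n : ℤ) :
    (latticeCoupling μ 0 : ℂ) ^ n = (((1 + μ ^ 2) ^ ((n : ℝ) / 2) : ℝ) : ℂ)⁻¹ := by
  have h : (0 : ℝ) ≤ 1 + μ ^ 2 := by positivity
  have e : ((1 + μ ^ 2) ^ ((n : ℝ) / 2) : ℝ) = √(1 + μ ^ 2) ^ n := by
    rw [Real.sqrt_eq_rpow, ← Real.rpow_intCast, ← Real.rpow_mul h]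
    congr 1
    ring
  rw [e, latticeCoupling]
  simp

end Assembly

theorem mainTheorem6 (m ε : ℝ) (hm : 0 < m) (hε : 0 < ε) :
    (∀ δ : ℝ, 0 < δ → δ < 1 →
      ∃! A : (ℝ → ℝ → ℂ) × (ℝ → ℝ → ℂ), IsAnticheckersField m ε δ A) ∧
    ∀ (x t : ℝ) (j n : ℤ), x / ε = j → t / ε = n →
      -- the limits defining the propagator exist
      Tendsto (fun δ => (anticheckersField m ε δ).1 x t) (𝓝[>] (0 : ℝ))
        (𝓝 (latticePropagator₁ x t m ε)) ∧
      Tendsto (fun δ => (anticheckersField m ε δ).2 x t) (𝓝[>] (0 : ℝ))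
        (𝓝 (latticePropagator₂ x t m ε)) ∧
      -- the principal branch is defined at the points where it is evaluated
      (∃ w : ℂ, IsGaussValue (1 / 2 + (|x| - t) / (2 * ε) : ℝ) (1 / 2 + (|x| - t) / (2 * ε) : ℝ)
        (1 + |x| / ε : ℝ) (-1 / (m ^ 2 * ε ^ 2) : ℝ) w) ∧
      (∃ w : ℂ, IsGaussValue ((|x| - t) / (2 * ε) : ℝ) (1 + (|x| - t) / (2 * ε) : ℝ)
        (1 + |x| / ε : ℝ) (-1 / (m ^ 2 * ε ^ 2) : ℝ) w) ∧
      -- the closed formulae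
      latticePropagator₁ x t m ε =
        (if t < 0 ∧ Even (j + n + 1) then -1 else 1) * Complex.I *
          ((-Complex.I * m * ε) ^ (n - |j|) / (((1 + m ^ 2 * ε ^ 2) ^ (t / (2 * ε)) : ℝ) : ℂ)) *
          (genBinom ((t + |x|) / (2 * ε) - 1 / 2) j.natAbs : ℂ) *
          gauss2F1 (1 / 2 + (|x| - t) / (2 * ε) : ℝ) (1 / 2 + (|x| - t) / (2 * ε) : ℝ)
            (1 + |x| / ε : ℝ) (-1 / (m ^ 2 * ε ^ 2) : ℝ) ∧
      latticePropagator₂ x t m ε =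
        (if t < 0 ∧ Even (j + n + 2) then -1 else 1) *
          ((-Complex.I * m * ε) ^ (n - |j|) / (((1 + m ^ 2 * ε ^ 2) ^ (t / (2 * ε)) : ℝ) : ℂ)) *
          (genBinom ((t + |x|) / (2 * ε) - 1 + heavisideStep x) j.natAbs : ℂ) *
          gauss2F1 ((|x| - t) / (2 * ε) : ℝ) (1 + (|x| - t) / (2 * ε) : ℝ)
            (1 + |x| / ε : ℝ) (-1 / (m ^ 2 * ε ^ 2) : ℝ) := by
  have hμ : 0 < m * ε := mul_pos hm hε
  refine ⟨fun δ h0 h1 => existsUnique_isAnticheckersField hm hε h0 (by nlinarith), ?_⟩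
  intro x t j n hx ht
  have hxe : x = ε * j := by rw [← hx]; field_simp
  have hte : t = ε * n := by rw [← ht]; field_simp
  have hlim := tendsto_anticheckersField hm hε j n
  rw [(greenField_eq_closedField hμ j n).1, (greenField_eq_closedField hμ j n).2, ← hxe,
    ← hte] at hlim
  have p1 : latticePropagator₁ x t m ε = (closedField (m * ε)).1 j n := hlim.1.limUnder_eq
  have p2 : latticePropagator₂ x t m ε = (closedField (m * ε)).2 j n := hlim.2.limUnder_eq
  have hj : (j.natAbs : ℤ) = |j| := Int.natCast_natAbs j
  have hxa : |x| = ε * j.natAbs := by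
    rw [hxe, abs_mul, abs_of_pos hε, Nat.cast_natAbs, Int.cast_abs]
  have a1 : |x| / ε = j.natAbs := by rw [hxa]; field_simp
  have a2 : (|x| - t) / (2 * ε) = (j.natAbs - n) / 2 := by rw [hxa, hte]; field_simp
  have a3 : (t + |x|) / (2 * ε) = (n + j.natAbs) / 2 := by rw [hxa, hte]; field_simp
  have a4 : t / (2 * ε) = (n : ℝ) / 2 := by rw [hte]; field_simp
  have a5 : t < 0 ↔ n < 0 := by
    rw [hte, mul_neg_iff]
    simp [hε, hε.not_gt]
  have a6 : heavisideStep x = heavisideStep j := by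
    simp only [heavisideStep, hxe, mul_nonneg_iff_of_pos_left hε]
  have a7 : m ^ 2 * ε ^ 2 = (m * ε) ^ 2 := (mul_pow m ε 2).symm
  have hc : ∀ k : ℕ, ((1 + j.natAbs : ℝ) : ℂ) + k ≠ 0 := fun k => by
    push_cast
    exact one_add_natCast_add_ne_zero _ k
  have hz : (((-1 / (m * ε) ^ 2 : ℝ) : ℂ)).re < 1 / 2 := by
    rw [Complex.ofReal_re, neg_div]
    have : 0 < 1 / (m * ε) ^ 2 := by positivity
    linarith
  rw [p1, p2, a1, a2, a3, a4, a6, a7]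
  simp only [a5]
  -- The point -1/μ² is negative, so it lies in the half-plane where Pfaff's transformation provides
  -- the continuation.
  refine ⟨hlim.1, hlim.2, ⟨_, isGaussValue_pfaff _ _ hc hz⟩, ⟨_, isGaussValue_pfaff _ _ hc hz⟩,
    ?_, ?_⟩
  · simp only [closedField, propagatorSign, closedFst]
    rw [latticeCoupling_zero_zpow, hj]
    push_cast
    rw [show ((1 : ℂ) / 2 + (j.natAbs - n) / 2) = (1 + j.natAbs - n) / 2 by ring]
    ring_nf
  · simp only [closedField, propagatorSign, closedSnd]
    rw [latticeCoupling_zero_zpow, hj]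
    push_cast
    rw [add_comm (1 : ℂ) (((j.natAbs : ℂ) - n) / 2)]
    ring_nf
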